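/- There is a deterministic parallel algorithm (a single program for a concurrent-read exclusive-write PRAM with real arithmetic, independent of its input) and constants $C$ and $k$ such that the following holds. Let $G=(V,E)$ be a finite simple graph with at least one edge and maximum degree $\Delta$, given by an adjacency array, and let $0<\varepsilon\le 1$. Let $$\rho_G^*=\max_{\emptyset\ne S\subseteq V}\frac{|E(S)|}{|S|},$$ where $E(S)$ is the set of edges of $G$ with both ends in $S$. On input $(G,\varepsilon)$ the algorithm halts and outputs a number $\tilde\rho$ with $$\tilde\rho\le\rho_G^*\le(1+\varepsilon)\,\tilde\rho,$$ its parallel time is at most $C\,\frac{\Delta}{\varepsilon}\,\log^k(|V|/\varepsilon)=\widetilde O(\Delta/\varepsilon)$, and its total work is at most $C\,\frac{\Delta|E|}{\varepsilon}\,\log^k(|V|/\varepsilon)=\widetilde O(\Delta|E|/\varepsilon)$. Here the parallel time is the length of the chain of successive operations and the total work is the number of all operations performed by all processors; an operation is a memory access, addition, subtraction, halving or comparison of indices, the conversion of an index to a real number, or one of $+,-,\times,/,\exp,\log,<$ on real numbers. -/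

import Mathlib

noncomputable section

/-! ### A concurrent-read exclusive-write parallel random access machine

Work-time presentation of a PRAM with a shared memory of natural numbers (indices) and of real
numbers.  The control flow is global.  One parallel instruction makes processors `0, …, L - 1`
simultaneously evaluate fixed expressions in the current memory and write one cell each.
A program is a finite syntactic object, so it cannot depend on the input. -/

namespace PRAM

/-- Shared memory: `nat a j` and `real a j` are the cells number `j` of the `a`-th natural and of
the `a`-th real array. -/
structure Mem where
  nat : ℕ → ℕ → ℕ
  real : ℕ → ℕ → ℝ

/-- Index expressions: constants, the processor number, a memory read, sum, truncated difference,
and half (rounded down). -/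
inductive NExp where
  | const (c : ℕ)
  | pid
  | read (a : ℕ) (i : NExp)
  | add (e₁ e₂ : NExp)
  | sub (e₁ e₂ : NExp)
  | half (e : NExp)

/-- Real expressions. Natural constants are obtained from `ofNat`; arbitrary real constants
are not available to a program. -/
inductive RExp where
  | ofNat (e : NExp)
  | read (a : ℕ) (i : NExp)
  | add (e₁ e₂ : RExp)
  | sub (e₁ e₂ : RExp)
  | mul (e₁ e₂ : RExp)
  | div (e₁ e₂ : RExp)
  | exp (e : RExp)
  | log (e : RExp)

/-- Tests: comparisons of indices and of reals, and their Boolean combinations. -/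
inductive BExp where
  | nlt (e₁ e₂ : NExp)
  | rlt (e₁ e₂ : RExp)
  | and (b₁ b₂ : BExp)
  | not (b : BExp)

/-- The value of an index expression for processor `i`. -/
def NExp.eval (σ : Mem) (i : ℕ) : NExp → ℕ
  | .const c => c
  | .pid => i
  | .read a e => σ.nat a (e.eval σ i)
  | .add e₁ e₂ => e₁.eval σ i + e₂.eval σ i
  | .sub e₁ e₂ => e₁.eval σ i - e₂.eval σ i
  | .half e => e.eval σ i / 2

/-- The value of a real expression for processor `i`. -/
def RExp.eval (σ : Mem) (i : ℕ) : RExp → ℝ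
  | .ofNat e => (e.eval σ i : ℝ)
  | .read a e => σ.real a (e.eval σ i)
  | .add e₁ e₂ => e₁.eval σ i + e₂.eval σ i
  | .sub e₁ e₂ => e₁.eval σ i - e₂.eval σ i
  | .mul e₁ e₂ => e₁.eval σ i * e₂.eval σ i
  | .div e₁ e₂ => e₁.eval σ i / e₂.eval σ i
  | .exp e => Real.exp (e.eval σ i)
  | .log e => Real.log (e.eval σ i)

/-- The truth value of a test for processor `i`. -/
def BExp.eval (σ : Mem) (i : ℕ) : BExp → Prop
  | .nlt e₁ e₂ => e₁.eval σ i < e₂.eval σ i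
  | .rlt e₁ e₂ => e₁.eval σ i < e₂.eval σ i
  | .and b₁ b₂ => b₁.eval σ i ∧ b₂.eval σ i
  | .not b => ¬ b.eval σ i

/-- The number of operations in an index expression. -/
def NExp.ops : NExp → ℕ
  | .const _ => 1
  | .pid => 1
  | .read _ e => e.ops + 1
  | .add e₁ e₂ => e₁.ops + e₂.ops + 1
  | .sub e₁ e₂ => e₁.ops + e₂.ops + 1
  | .half e => e.ops + 1

/-- The number of operations in a real expression. -/
def RExp.ops : RExp → ℕ
  | .ofNat e => e.ops + 1
  | .read _ e => e.ops + 1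
  | .add e₁ e₂ => e₁.ops + e₂.ops + 1
  | .sub e₁ e₂ => e₁.ops + e₂.ops + 1
  | .mul e₁ e₂ => e₁.ops + e₂.ops + 1
  | .div e₁ e₂ => e₁.ops + e₂.ops + 1
  | .exp e => e.ops + 1
  | .log e => e.ops + 1

/-- The number of operations in a test. -/
def BExp.ops : BExp → ℕ
  | .nlt e₁ e₂ => e₁.ops + e₂.ops + 1
  | .rlt e₁ e₂ => e₁.ops + e₂.ops + 1
  | .and b₁ b₂ => b₁.ops + b₂.ops + 1
  | .not b => b.ops + 1

/-- Programs. `setN a len idx val guard` is the parallel instruction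
`for all i < len with guard i, in parallel: nat[a][idx i] := val i`, and `setR` does the same
in a real array. -/
inductive Cmd where
  | setN (a : ℕ) (len idx val : NExp) (guard : BExp)
  | setR (a : ℕ) (len idx : NExp) (val : RExp) (guard : BExp)
  | seq (c₁ c₂ : Cmd)
  | ite (b : BExp) (c₁ c₂ : Cmd)
  | loop (b : BExp) (c : Cmd)

/-- The processors that write in a parallel instruction. -/
def writers (σ : Mem) (len : NExp) (guard : BExp) : Set ℕ :=
  {i | i < len.eval σ 0 ∧ guard.eval σ i}

open Classical in
/-- The array `A` after every `i ∈ I` has written `val i` into the cell `addr i`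
(used only when `addr` is injective on `I`). -/
def scatter {α : Type} (A : ℕ → α) (I : Set ℕ) (addr : ℕ → ℕ) (val : ℕ → α) : ℕ → α :=
  fun j => if h : ∃ i ∈ I, addr i = j then val h.choose else A j

/-- `Exec c σ σ' t w`: the program `c`, started in memory `σ`, halts in memory `σ'` after parallel
time `t` (the operations of the processors of one parallel instruction are simultaneous), having
performed `w` operations in total (the operations of each processor of a parallel instruction
are counted, whether or not its guard holds). Two processors never write to the same cell. -/
inductive Exec : Cmd → Mem → Mem → ℕ → ℕ → Prop where
  | setN (σ : Mem) (a : ℕ) (len idx val : NExp) (guard : BExp)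
      (excl : Set.InjOn (fun i => idx.eval σ i) (writers σ len guard)) :
      Exec (.setN a len idx val guard) σ
        (Mem.mk (Function.update σ.nat a (scatter (σ.nat a) (writers σ len guard)
            (fun i => idx.eval σ i) (fun i => val.eval σ i))) σ.real)
        (len.ops + (guard.ops + idx.ops + val.ops + 1))
        (len.ops + len.eval σ 0 * (guard.ops + idx.ops + val.ops + 1))
  | setR (σ : Mem) (a : ℕ) (len idx : NExp) (val : RExp) (guard : BExp)
      (excl : Set.InjOn (fun i => idx.eval σ i) (writers σ len guard)) :
      Exec (.setR a len idx val guard) σ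
        (Mem.mk σ.nat (Function.update σ.real a (scatter (σ.real a) (writers σ len guard)
            (fun i => idx.eval σ i) (fun i => val.eval σ i))))
        (len.ops + (guard.ops + idx.ops + val.ops + 1))
        (len.ops + len.eval σ 0 * (guard.ops + idx.ops + val.ops + 1))
  | seq {c₁ c₂ : Cmd} {σ₁ σ₂ σ₃ : Mem} {t₁ t₂ w₁ w₂ : ℕ}
      (h₁ : Exec c₁ σ₁ σ₂ t₁ w₁) (h₂ : Exec c₂ σ₂ σ₃ t₂ w₂) :
      Exec (.seq c₁ c₂) σ₁ σ₃ (t₁ + t₂) (w₁ + w₂)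
  | ite_true {b : BExp} {c₁ c₂ : Cmd} {σ σ' : Mem} {t w : ℕ}
      (hb : b.eval σ 0) (h : Exec c₁ σ σ' t w) :
      Exec (.ite b c₁ c₂) σ σ' (b.ops + t) (b.ops + w)
  | ite_false {b : BExp} {c₁ c₂ : Cmd} {σ σ' : Mem} {t w : ℕ}
      (hb : ¬ b.eval σ 0) (h : Exec c₂ σ σ' t w) :
      Exec (.ite b c₁ c₂) σ σ' (b.ops + t) (b.ops + w)
  | loop_done {b : BExp} {c : Cmd} {σ : Mem} (hb : ¬ b.eval σ 0) :
      Exec (.loop b c) σ σ b.ops b.ops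
  | loop_step {b : BExp} {c : Cmd} {σ₁ σ₂ σ₃ : Mem} {t₁ t₂ w₁ w₂ : ℕ}
      (hb : b.eval σ₁ 0) (h₁ : Exec c σ₁ σ₂ t₁ w₁) (h₂ : Exec (.loop b c) σ₂ σ₃ t₂ w₂) :
      Exec (.loop b c) σ₁ σ₃ (b.ops + t₁ + t₂) (b.ops + w₁ + w₂)

/-- Input memory: natural array `0` holds the offsets and array `1` the neighbours of an adjacency
array, array `2` the number of vertices in cell `0`; real array `0` holds `ε` in cell `0`;
all other cells are `0`. -/
def inputMem (n : ℕ) (off adj : ℕ → ℕ) (ε : ℝ) : Mem where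
  nat := fun a j =>
    if a = 0 then off j else if a = 1 then adj j else if a = 2 ∧ j = 0 then n else 0
  real := fun a j => if a = 0 ∧ j = 0 then ε else 0

/-- The output of a program is the real number in cell `0` of real array `1`. -/
def Mem.output (σ : Mem) : ℝ := σ.real 1 0

end PRAM

/-- `off`, `adj` is an adjacency-array representation of `G`: the neighbours of the vertex `v`,
in any order, are `adj j` for `off v ≤ j < off (v + 1)`. -/
structure IsAdjacencyArray {n : ℕ} (G : SimpleGraph (Fin n)) [DecidableRel G.Adj]
    (off adj : ℕ → ℕ) : Prop where
  off_zero : off 0 = 0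
  off_succ : ∀ v : Fin n, off ((v : ℕ) + 1) = off (v : ℕ) + G.degree v
  adj_bijOn : ∀ v : Fin n,
    Set.BijOn adj (Set.Ico (off (v : ℕ)) (off ((v : ℕ) + 1))) {w | ∃ u : Fin n, G.Adj v u ∧ (u : ℕ) = w}

/-- `|E(S)| / |S|`, where `E(S)` is the set of edges with both ends in `S`. -/
def subgraphDensity {n : ℕ} (G : SimpleGraph (Fin n)) [DecidableRel G.Adj]
    (S : Finset (Fin n)) : ℝ :=
  ((G.edgeFinset.filter (fun e => ∀ v ∈ e, v ∈ S)).card : ℝ) / (S.card : ℝ)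

/-- The maximum subgraph density: the maximum of `|E(S)| / |S|` over the nonempty `S ⊆ V`
(a finite family). -/
def maxSubgraphDensity {n : ℕ} (G : SimpleGraph (Fin n)) [DecidableRel G.Adj] : ℝ :=
  ⨆ S : {S : Finset (Fin n) // S.Nonempty}, subgraphDensity G S.1

end

/-! Let `y` range over probability vectors on the nonisolated vertices. Peeling off level sets shows
that the maximum over `y` of the sum of `min (y u) (y v)` over all darts `uv` is `2ρ*`, attained at
a uniform distribution on a vertex set (`sum_min_le`, `density_le`). Since `2 min(a, b)` is the
minimum of `a + b + x(a - b)` over `|x| ≤ 1`, the number `4ρ*` is the value of a bilinear game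
between a box vector `x` on the darts and a simplex vector `y`. The vector `x` may be taken
antisymmetric under reversal of darts.

The game is solved by dual extrapolation with an area-convex regularizer in the sense of Sherman:
the sum of `(y_tail + y_head) x^2` over the darts plus `L` times the negative entropy of `y`, with
`L` a constant multiple of an upper bound `dl = O(Δ)` for the degrees. It is strong enough to
control the bilinear coupling (`area_convex`, `reg_area_convex`), yet its range is only `O(Δ log n)`
because the quadratic part is weighted by `y`. So `O(Δ log n / ε)` steps bring the average simplex
iterate within `ε/4` of optimal (`extrapolation_step`, `regret_le`, `minSum_le_average`). As `ρ* ≥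
1/2`, this additive error is a relative one.

Each step needs two approximate minimizations of a linear functional plus the regularizer. Both
block minimizations are explicit (a clipped quotient for `x`, a softmax for `y`), and since `L`
dominates the degrees, alternating between them halves a relative entropy in every round as long as
the target value is not reached (`alt_converges`). Logarithmically many rounds suffice.

On the machine, a vertex vector is stored once per dart at its tail, so `2|E| + 1` processors
suffice however many isolated vertices there are. Antisymmetry removes the need to locate reverse
darts: every vertex sum is over a contiguous segment of outgoing darts, a difference of two prefix
sums computed by doubling. Costs are tracked by `Runs` as text length times number of repetitions
times number of processors. -/

noncomputable section

set_option linter.unusedSectionVars false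

/-! ### Scalar inequalities -/

/-- The generalized relative entropy of two nonnegative numbers. -/
def klTerm (s s' : ℝ) : ℝ := s * Real.log s - s * Real.log s' - s + s'

lemma klTerm_self (s : ℝ) : klTerm s s = 0 := by unfold klTerm; ring

/-- The squared Hellinger distance lies in between: `log r ≤ r - 1` at `r = √(s'/s)` gives `klTerm s
s' ≥ (√s' - √s)^2`, and `(√s' + √s)^2 ≤ 4 * m`. -/
lemma sq_sub_le_klTerm {s s' m : ℝ} (hs : 0 ≤ s) (hs' : 0 < s') (h1 : s ≤ m) (h2 : s' ≤ m) :
    (s' - s) ^ 2 ≤ 4 * m * klTerm s s' := by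
  rcases hs.eq_or_lt with rfl | hs
  · simp only [klTerm]; nlinarith
  · set r := Real.sqrt (s' / s) with hr
    have hr0 : 0 < r := Real.sqrt_pos.2 (by positivity)
    have hr2 : s' = r ^ 2 * s := by
      rw [hr, Real.sq_sqrt (by positivity)]; field_simp
    have hlog : Real.log s' = 2 * Real.log r + Real.log s := by
      rw [hr2, Real.log_mul (by positivity) hs.ne', Real.log_pow]; norm_num
    have hl : Real.log r ≤ r - 1 := Real.log_le_sub_one_of_pos hr0
    have hk : s * (r - 1) ^ 2 ≤ klTerm s s' := by
      unfold klTerm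
      rw [hlog, hr2]
      nlinarith [mul_le_mul_of_nonneg_left hl hs.le]
    have hm : s * (1 + r) ^ 2 ≤ 4 * m := by nlinarith [mul_nonneg hs.le (sq_nonneg (r - 1))]
    calc (s' - s) ^ 2 = (s * (1 + r) ^ 2) * (s * (r - 1) ^ 2) := by rw [hr2]; ring
      _ ≤ (4 * m) * klTerm s s' := mul_le_mul hm hk (by positivity) (by linarith)

lemma klTerm_nonneg {s s' : ℝ} (hs : 0 ≤ s) (hs' : 0 < s') : 0 ≤ klTerm s s' := by
  have h := sq_sub_le_klTerm hs hs' (le_max_left s s') (le_max_right s s')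
  have hm : 0 < 4 * max s s' := by have := le_max_right s s'; linarith
  by_contra hc
  nlinarith [sq_nonneg (s' - s), mul_pos hm (neg_pos.2 (not_le.1 hc))]

/-- Relative smoothness, for one coordinate. -/
lemma shift_le_klTerm {y y' x d : ℝ} (hy : 0 ≤ y) (hy' : 0 < y') (hx : |x| ≤ 1) (hd : |d| ≤ 2) :
    2 * (y' - y) * x * d - y * d ^ 2 ≤ 16 * klTerm y y' := by
  have h1 : 2 * (y' - y) * x * d ≤ 2 * |y' - y| * |d| := by
    calc 2 * (y' - y) * x * d ≤ |2 * (y' - y) * x * d| := le_abs_self _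
      _ = 2 * |y' - y| * |d| * |x| := by simp only [abs_mul, abs_two]; ring
      _ ≤ 2 * |y' - y| * |d| * 1 := by gcongr
      _ = _ := by ring
  have hb : |y' - y| ^ 2 = (y' - y) ^ 2 := sq_abs _
  have hdd : |d| ^ 2 = d ^ 2 := sq_abs _
  have h0 := abs_nonneg (y' - y)
  have h0d := abs_nonneg d
  -- Complete the square with the larger of `y`, `y'` as the weight of `d ^ 2`. If that is `y'`,
  -- changing the weight costs `(y' - y) * d ^ 2`, which `|d| ≤ 2` absorbs into the cross term;
  -- doubling that term is why the constant is 16 and not 4.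
  rcases le_total y' y with h | h
  · have hk := sq_sub_le_klTerm hy hy' le_rfl h
    have hy0 : 0 < y := lt_of_lt_of_le hy' h
    have hq : y * (2 * |y' - y| * |d| - y * d ^ 2) ≤ y * (16 * klTerm y y') := by
      rw [← hb] at hk
      rw [← hdd]
      have := mul_nonneg hy (klTerm_nonneg hy hy')
      linarith [sq_nonneg (|y' - y| - y * |d|)]
    have := le_of_mul_le_mul_left hq hy0
    linarith
  · have hk := sq_sub_le_klTerm hy hy' h le_rfl
    have he : |y' - y| = y' - y := abs_of_nonneg (by linarith)
    have hq : y' * (4 * |y' - y| * |d| - y' * d ^ 2) ≤ y' * (16 * klTerm y y') := by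
      rw [← hb] at hk
      rw [← hdd]
      linarith [sq_nonneg (2 * |y' - y| - y' * |d|)]
    have h3 := le_of_mul_le_mul_left hq hy'
    have h4 : (y' - y) * d ^ 2 ≤ 2 * |y' - y| * |d| := by
      rw [he, ← hdd]
      nlinarith [mul_nonneg (sub_nonneg.2 h) h0d]
    nlinarith

/-- The convexity gap of `y ↦ y log y` for three points and their mean. -/
def entGap (a b c : ℝ) : ℝ :=
  a * Real.log a + b * Real.log b + c * Real.log c
    - 3 * ((a + b + c) / 3 * Real.log ((a + b + c) / 3))

/-- The gap is the sum of the relative entropies of the three points to their mean. Each point is at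
most three times the mean, so the quadratic lower bound applies with `3 * m`. -/
lemma entGap_ge {a b c m : ℝ} (ha : 0 ≤ a) (hb : 0 ≤ b) (hc : 0 ≤ c) (hm : m = (a + b + c) / 3)
    (hm0 : 0 < m) :
    (m - a) ^ 2 + (m - b) ^ 2 + (m - c) ^ 2 ≤ 12 * m * entGap a b c := by
  have h1 := sq_sub_le_klTerm (m := 3 * m) ha hm0 (by linarith) (by linarith)
  have h2 := sq_sub_le_klTerm (m := 3 * m) hb hm0 (by linarith) (by linarith)
  have h3 := sq_sub_le_klTerm (m := 3 * m) hc hm0 (by linarith) (by linarith)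
  have h4 : entGap a b c = klTerm a m + klTerm b m + klTerm c m := by
    unfold entGap klTerm
    rw [← hm]
    have : a = 3 * m - b - c := by linarith
    subst this; ring
  rw [h4]; linarith

lemma entGap_nonneg {a b c : ℝ} (ha : 0 ≤ a) (hb : 0 ≤ b) (hc : 0 ≤ c) : 0 ≤ entGap a b c := by
  rcases (show 0 ≤ (a + b + c) / 3 by linarith).eq_or_lt with h | h
  · have h1 : a = 0 := by linarith
    have h2 : b = 0 := by linarith
    have h3 : c = 0 := by linarith
    simp [entGap, h1, h2, h3]
  · have h1 := entGap_ge ha hb hc rfl h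
    by_contra hc
    nlinarith [sq_nonneg ((a + b + c) / 3 - a), sq_nonneg ((a + b + c) / 3 - b),
      sq_nonneg ((a + b + c) / 3 - c), mul_pos h (neg_pos.2 (not_le.1 hc))]

/-- Replaces the weight `m + b` by half of the mean weight at the price `2 * b ^ 2`: `|a| ≤ 2` makes
the deviation `m * b * a ^ 2` bilinear in `|a|` and `|b|`, and AM-GM splits it. -/
lemma weighted_sq_ge {m a b : ℝ} (hm : 0 < m) (ha : |a| ≤ 2) :
    m * (m * a ^ 2 / 2) ≤ m * ((m + b) * a ^ 2) + 2 * b ^ 2 := by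
  have h1 : -(m * b * a ^ 2) ≤ m * (2 * |b| * |a|) := by
    calc -(m * b * a ^ 2) ≤ |-(m * b * a ^ 2)| := le_abs_self _
      _ = m * (|b| * |a| * |a|) := by
        rw [abs_neg, abs_mul, abs_mul, abs_of_pos hm, abs_pow]; ring
      _ ≤ m * (|b| * |a| * 2) := by gcongr
      _ = _ := by ring
  rw [← sq_abs a] at h1 ⊢
  rw [← sq_abs b]
  linarith [sq_nonneg (m * |a| - 2 * |b|)]

/-- Area convexity of `y x ^ 2 + 420 y log y` on `[-1, 1] × [0, ∞)`. -/
lemma area_convex {x₁ x₂ x₃ y₁ y₂ y₃ : ℝ} (hx₁ : |x₁| ≤ 1) (hx₂ : |x₂| ≤ 1) (hx₃ : |x₃| ≤ 1)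
    (hy₁ : 0 ≤ y₁) (hy₂ : 0 ≤ y₂) (hy₃ : 0 ≤ y₃) :
    2 * ((x₂ - x₁) * (y₃ - y₁) - (x₃ - x₁) * (y₂ - y₁)) ≤
      y₁ * x₁ ^ 2 + y₂ * x₂ ^ 2 + y₃ * x₃ ^ 2
        - 3 * ((y₁ + y₂ + y₃) / 3 * ((x₁ + x₂ + x₃) / 3) ^ 2) + 420 * entGap y₁ y₂ y₃ := by
  set m := (y₁ + y₂ + y₃) / 3 with hm
  rcases (show 0 ≤ m by linarith).eq_or_lt with h | h
  · have h1 : y₁ = 0 := by linarith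
    have h2 : y₂ = 0 := by linarith
    have h3 : y₃ = 0 := by linarith
    rw [← h]
    simp [entGap, h1, h2, h3]
  · have hE := entGap_ge hy₁ hy₂ hy₃ hm h
    set E := entGap y₁ y₂ y₃
    set c := (x₁ + x₂ + x₃) / 3 with hc
    rw [abs_le] at hx₁ hx₂ hx₃
    obtain ⟨a₁, ha₁⟩ : ∃ a, a = x₁ - c := ⟨_, rfl⟩
    obtain ⟨a₂, ha₂⟩ : ∃ a, a = x₂ - c := ⟨_, rfl⟩
    obtain ⟨b₁, hb₁⟩ : ∃ a, a = y₁ - m := ⟨_, rfl⟩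
    obtain ⟨b₂, hb₂⟩ : ∃ a, a = y₂ - m := ⟨_, rfl⟩
    have e1 : x₁ = c + a₁ := by linarith
    have e2 : x₂ = c + a₂ := by linarith
    have e3 : x₃ = c - a₁ - a₂ := by linarith
    have f1 : y₁ = m + b₁ := by linarith
    have f2 : y₂ = m + b₂ := by linarith
    have f3 : y₃ = m + (- b₁ - b₂) := by linarith
    have hc1 : |c| ≤ 1 := by rw [abs_le]; constructor <;> linarith
    have w1 := weighted_sq_ge (b := b₁) h (show |a₁| ≤ 2 by rw [abs_le]; constructor <;> linarith)
    have w2 := weighted_sq_ge (b := b₂) h (show |a₂| ≤ 2 by rw [abs_le]; constructor <;> linarith)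
    have w3 := weighted_sq_ge (b := -b₁ - b₂) h
      (show |-a₁ - a₂| ≤ 2 by rw [abs_le]; constructor <;> linarith)
    have cross : ∀ a b : ℝ, -(2 * c * (m * a * b)) ≤ m ^ 2 * a ^ 2 / 8 + 8 * b ^ 2 := by
      intro a b
      rw [abs_le] at hc1
      have : 0 ≤ (1 - c) * (1 + c) := mul_nonneg (by linarith) (by linarith)
      nlinarith [sq_nonneg (m * a + 8 * (c * b)), mul_nonneg this (sq_nonneg b)]
    have c1 := cross a₁ b₁
    have c2 := cross a₂ b₂
    have c3 := cross (-a₁ - a₂) (-b₁ - b₂)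
    -- In the deviations `aᵢ`, `bᵢ` from the means, which sum to zero, the left side is `6 (a₁ b₂ -
    -- a₂ b₁)` and the quadratic part is the sum of `(m + bᵢ) aᵢ^2 + 2 c aᵢ bᵢ`. After
    -- multiplication by `m`, the available `m^2 aᵢ^2 / 2` pays `1/8` for the cross terms and `3/8`
    -- for the area; the terms `bᵢ^2` need `2 + 8 + 24 = 34`, while the entropy supplies `420 / 12 =
    -- 35`.
    have key : m * (2 * ((x₂ - x₁) * (y₃ - y₁) - (x₃ - x₁) * (y₂ - y₁))) ≤
      m * (y₁ * x₁ ^ 2 + y₂ * x₂ ^ 2 + y₃ * x₃ ^ 2 - 3 * (m * c ^ 2) + 420 * E) := by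
      clear_value E m c
      subst e1 e2 e3 f1 f2 f3
      have d1 : 6 * (m * a₁ * b₂) ≤ 3 * (m ^ 2 * a₁ ^ 2 / 8 + 8 * b₂ ^ 2) := by
        linarith [sq_nonneg (m * a₁ - 8 * b₂)]
      have d2 : -6 * (m * a₂ * b₁) ≤ 3 * (m ^ 2 * a₂ ^ 2 / 8 + 8 * b₁ ^ 2) := by
        linarith [sq_nonneg (m * a₂ + 8 * b₁)]
      have p3 : 0 ≤ (m * (-a₁ - a₂)) ^ 2 := sq_nonneg _
      have q3 : 0 ≤ (-b₁ - b₂) ^ 2 := sq_nonneg _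
      linarith [sq_nonneg b₁, sq_nonneg b₂, mul_nonneg (sq_nonneg m) (sq_nonneg a₁)]
    exact le_of_mul_le_mul_left key h

/-! ### The box-simplex game of a dart graph and its area-convex regularizer -/

/-- A finite symmetric digraph: darts with a tail and a reversal. -/
structure DartGraph (D W : Type) where
  tail : D → W
  rev : D → D
  rev_rev : ∀ j, rev (rev j) = j

namespace DartGraph

variable {D W : Type} [Fintype D] [Fintype W] [DecidableEq W] (Γ : DartGraph D W)

/-- The head of a dart. -/
def head (j : D) : W := Γ.tail (Γ.rev j)

lemma head_rev (j : D) : Γ.head (Γ.rev j) = Γ.tail j := by rw [head, Γ.rev_rev]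

/-- The sum of a function over the darts leaving a vertex. -/
def outSum (a : D → ℝ) (w : W) : ℝ := ∑ j with Γ.tail j = w, a j

/-- The out-degree. -/
def deg (w : W) : ℝ := Γ.outSum (fun _ => 1) w

lemma sum_rev (F : D → ℝ) : ∑ j, F (Γ.rev j) = ∑ j, F j :=
  Equiv.sum_comp (⟨Γ.rev, Γ.rev, Γ.rev_rev, Γ.rev_rev⟩ : D ≃ D) F

lemma sum_mul_outSum (a : D → ℝ) (y : W → ℝ) :
    ∑ w, y w * Γ.outSum a w = ∑ j, a j * y (Γ.tail j) := by
  simp only [outSum, Finset.mul_sum]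
  rw [← Finset.sum_fiberwise (s := Finset.univ) (g := Γ.tail)
    (f := fun j => a j * y (Γ.tail j))]
  refine Finset.sum_congr rfl fun w _ => Finset.sum_congr rfl fun j hj => ?_
  rw [(Finset.mem_filter.1 hj).2, mul_comm]

lemma sum_tail (F : W → ℝ) : ∑ j, F (Γ.tail j) = ∑ w, F w * Γ.deg w := by
  have h := Γ.sum_mul_outSum (fun _ => 1) F
  simp only [one_mul] at h
  exact h.symm

lemma sum_head (F : W → ℝ) : ∑ j, F (Γ.head j) = ∑ j, F (Γ.tail j) :=
  Γ.sum_rev (fun j => F (Γ.tail j))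

/-- Each vertex is counted once per outgoing and once per incoming dart. This factor `2 * dl` is the
exchange rate between inequalities per dart and the entropy per vertex; it turns 420 into 840 and 16
into 32. -/
lemma sum_tail_add_head_le {dl : ℝ} (hd : ∀ w, Γ.deg w ≤ dl) {F : W → ℝ} (hF : ∀ w, 0 ≤ F w) :
    ∑ j, (F (Γ.tail j) + F (Γ.head j)) ≤ 2 * dl * ∑ w, F w := by
  have h : ∑ w, F w * Γ.deg w ≤ dl * ∑ w, F w := by
    rw [Finset.mul_sum]
    refine Finset.sum_le_sum fun w _ => ?_
    rw [mul_comm]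
    exact mul_le_mul_of_nonneg_right (hd w) (hF w)
  rw [Finset.sum_add_distrib, sum_head, sum_tail]
  linarith

/-- Pairs of an antisymmetric vector in the unit box and a probability vector. -/
structure Feas (x : D → ℝ) (y : W → ℝ) : Prop where
  anti : ∀ j, x (Γ.rev j) = -x j
  box : ∀ j, |x j| ≤ 1
  nonneg : ∀ w, 0 ≤ y w
  sum_one : ∑ w, y w = 1

/-- The regularizer. -/
def reg (L : ℝ) (x : D → ℝ) (y : W → ℝ) : ℝ :=
  ∑ j, (y (Γ.tail j) + y (Γ.head j)) * x j ^ 2 + L * ∑ w, y w * Real.log (y w)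

/-- A linear functional. -/
def lin (p : D → ℝ) (q : W → ℝ) (x : D → ℝ) (y : W → ℝ) : ℝ :=
  ∑ j, p j * x j + ∑ w, q w * y w

/-- The regularized linear functional. -/
def obj (L : ℝ) (p : D → ℝ) (q : W → ℝ) (x : D → ℝ) (y : W → ℝ) : ℝ :=
  lin p q x y + Γ.reg L x y

/-- The payoff of the box-simplex game. -/
def payoff (x : D → ℝ) (y : W → ℝ) : ℝ :=
  ∑ w, 2 * Γ.deg w * y w + ∑ j, x j * (y (Γ.tail j) - y (Γ.head j))

/-- The gradient of the payoff in the box variable. -/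
def gradX (y : W → ℝ) (j : D) : ℝ := y (Γ.tail j) - y (Γ.head j)

/-- The negative gradient of the payoff in the simplex variable. -/
def gradY (x : D → ℝ) (w : W) : ℝ := -(2 * Γ.deg w + 2 * Γ.outSum x w)

variable {Γ}

/-- Reversal preserves `x j ^ 2`, so the head terms fold onto the tail terms. The quadratic part is
thus linear in `y` with coefficients read off the outgoing darts, which makes the minimizer in `y` a
softmax. -/
lemma Feas.sum_sq {x : D → ℝ} (hx : ∀ j, x (Γ.rev j) = -x j) (y : W → ℝ) :
    ∑ j, (y (Γ.tail j) + y (Γ.head j)) * x j ^ 2 =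
      ∑ w, 2 * Γ.outSum (fun j => x j ^ 2) w * y w := by
  have h1 : ∑ j, y (Γ.head j) * x j ^ 2 = ∑ j, y (Γ.tail j) * x j ^ 2 := by
    rw [← Γ.sum_rev]
    simp only [head_rev, hx, neg_sq]
  have h2 := Γ.sum_mul_outSum (fun j => x j ^ 2) y
  simp only [add_mul, Finset.sum_add_distrib, h1]
  have h3 : ∀ w, 2 * Γ.outSum (fun j => x j ^ 2) w * y w
      = 2 * (y w * Γ.outSum (fun j => x j ^ 2) w) := fun w => by ring
  simp only [h3, ← Finset.mul_sum, h2]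
  simp only [two_mul, mul_comm]

/-- The same folding for the coupling term, where the sign change of `x` under reversal matches the
minus sign at the head. -/
lemma sum_outSum_anti {x : D → ℝ} (hx : ∀ j, x (Γ.rev j) = -x j) (y : W → ℝ) :
    ∑ w, 2 * Γ.outSum x w * y w = ∑ j, x j * (y (Γ.tail j) - y (Γ.head j)) := by
  have h1 : ∑ j, x j * y (Γ.head j) = - ∑ j, x j * y (Γ.tail j) := by
    rw [← Γ.sum_rev, ← Finset.sum_neg_distrib]
    simp only [head_rev, hx, neg_mul]
  have h2 := Γ.sum_mul_outSum x y
  simp only [mul_sub, Finset.sum_sub_distrib, h1]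
  have h3 : ∀ w, 2 * Γ.outSum x w * y w = 2 * (y w * Γ.outSum x w) := fun w => by ring
  simp only [h3, ← Finset.mul_sum, h2]
  ring

/-- The linear functional given by the gradients, in terms of the payoff. -/
lemma lin_grad {x : D → ℝ} (hx : ∀ j, x (Γ.rev j) = -x j) (y : W → ℝ)
    (x' : D → ℝ) (y' : W → ℝ) :
    lin (Γ.gradX y) (Γ.gradY x) x' y' = Γ.payoff x' y - Γ.payoff x y'
      - ∑ w, 2 * Γ.deg w * y w := by
  have h := sum_outSum_anti hx y'
  have h2 : ∑ w, Γ.gradY x w * y' w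
      = -(∑ w, 2 * Γ.deg w * y' w) - ∑ w, 2 * Γ.outSum x w * y' w := by
    rw [← Finset.sum_neg_distrib, ← Finset.sum_sub_distrib]
    exact Finset.sum_congr rfl fun w _ => by unfold gradY; ring
  unfold lin payoff
  rw [h2, h]
  simp only [gradX, mul_comm]
  ring

lemma lin_add (p p' : D → ℝ) (q q' : W → ℝ) (c : ℝ) (x : D → ℝ) (y : W → ℝ) :
    lin (fun j => p j + c * p' j) (fun w => q w + c * q' w) x y
      = lin p q x y + c * lin p' q' x y := by
  simp only [lin, add_mul, Finset.sum_add_distrib, Finset.mul_sum, mul_add, mul_assoc]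
  ring

lemma obj_add (L : ℝ) (p p' : D → ℝ) (q q' : W → ℝ) (c : ℝ) (x : D → ℝ) (y : W → ℝ) :
    Γ.obj L (fun j => p j + c * p' j) (fun w => q w + c * q' w) x y
      = Γ.obj L p q x y + c * lin p' q' x y := by
  simp only [obj, lin_add]; ring

lemma Feas.centroid {x₁ x₂ x₃ : D → ℝ} {y₁ y₂ y₃ : W → ℝ} (h₁ : Γ.Feas x₁ y₁)
    (h₂ : Γ.Feas x₂ y₂) (h₃ : Γ.Feas x₃ y₃) :
    Γ.Feas (fun j => (x₁ j + x₂ j + x₃ j) / 3) (fun w => (y₁ w + y₂ w + y₃ w) / 3) where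
  anti j := by simp only [h₁.anti, h₂.anti, h₃.anti]; ring
  box j := by
    have a := abs_le.1 (h₁.box j)
    have b := abs_le.1 (h₂.box j)
    have c := abs_le.1 (h₃.box j)
    rw [abs_le]; constructor <;> linarith
  nonneg w := by
    have := h₁.nonneg w; have := h₂.nonneg w; have := h₃.nonneg w
    positivity
  sum_one := by
    rw [← Finset.sum_div, Finset.sum_add_distrib, Finset.sum_add_distrib, h₁.sum_one, h₂.sum_one,
      h₃.sum_one]
    norm_num

/-- Area convexity of the regularizer. -/
lemma reg_area_convex {dl L : ℝ} (hd : ∀ w, Γ.deg w ≤ dl) (hL : 840 * dl ≤ L)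
    {x₁ x₂ x₃ : D → ℝ} {y₁ y₂ y₃ : W → ℝ} (h₁ : Γ.Feas x₁ y₁)
    (h₂ : Γ.Feas x₂ y₂) (h₃ : Γ.Feas x₃ y₃) :
    2 * ∑ j, ((x₂ j - x₁ j) * (Γ.gradX y₃ j - Γ.gradX y₁ j)
        - (x₃ j - x₁ j) * (Γ.gradX y₂ j - Γ.gradX y₁ j)) ≤
      Γ.reg L x₁ y₁ + Γ.reg L x₂ y₂ + Γ.reg L x₃ y₃
        - 3 * Γ.reg L (fun j => (x₁ j + x₂ j + x₃ j) / 3) (fun w => (y₁ w + y₂ w + y₃ w) / 3) := by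
  set e : W → ℝ := fun w => entGap (y₁ w) (y₂ w) (y₃ w) with he
  have he0 : ∀ w, 0 ≤ e w := fun w => entGap_nonneg (h₁.nonneg w) (h₂.nonneg w) (h₃.nonneg w)
  have hsum := Γ.sum_tail_add_head_le hd he0
  have hE : 420 * ∑ j, (e (Γ.tail j) + e (Γ.head j)) ≤ L * ∑ w, e w := by
    have := mul_le_mul_of_nonneg_right hL (Finset.sum_nonneg fun w (_ : w ∈ Finset.univ) => he0 w)
    linarith
  have hL' : L * ∑ w, e w = L * ∑ w, y₁ w * Real.log (y₁ w) + L * ∑ w, y₂ w * Real.log (y₂ w)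
      + L * ∑ w, y₃ w * Real.log (y₃ w)
      - 3 * (L * ∑ w, ((y₁ w + y₂ w + y₃ w) / 3 * Real.log ((y₁ w + y₂ w + y₃ w) / 3))) := by
    simp only [he, entGap, Finset.sum_sub_distrib, Finset.sum_add_distrib, ← Finset.mul_sum]
    ring
  have hj : 2 * ∑ j, ((x₂ j - x₁ j) * (Γ.gradX y₃ j - Γ.gradX y₁ j)
        - (x₃ j - x₁ j) * (Γ.gradX y₂ j - Γ.gradX y₁ j)) ≤
      ∑ j, (y₁ (Γ.tail j) + y₁ (Γ.head j)) * x₁ j ^ 2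
      + ∑ j, (y₂ (Γ.tail j) + y₂ (Γ.head j)) * x₂ j ^ 2
      + ∑ j, (y₃ (Γ.tail j) + y₃ (Γ.head j)) * x₃ j ^ 2
      - 3 * ∑ j, ((y₁ (Γ.tail j) + y₂ (Γ.tail j) + y₃ (Γ.tail j)) / 3
          + (y₁ (Γ.head j) + y₂ (Γ.head j) + y₃ (Γ.head j)) / 3)
          * ((x₁ j + x₂ j + x₃ j) / 3) ^ 2
      + 420 * ∑ j, (e (Γ.tail j) + e (Γ.head j)) := by
    simp only [Finset.mul_sum, ← Finset.sum_add_distrib, ← Finset.sum_sub_distrib]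
    refine Finset.sum_le_sum fun j _ => ?_
    have a := area_convex (h₁.box j) (h₂.box j) (h₃.box j) (h₁.nonneg (Γ.tail j))
      (h₂.nonneg (Γ.tail j)) (h₃.nonneg (Γ.tail j))
    -- The head enters the coupling with the opposite sign, which is the orientation obtained by
    -- exchanging the second and third points.
    have b := area_convex (x₁ := x₁ j) (x₂ := x₃ j) (x₃ := x₂ j) (h₁.box j) (h₃.box j) (h₂.box j)
      (h₁.nonneg (Γ.head j)) (h₃.nonneg (Γ.head j)) (h₂.nonneg (Γ.head j))
    have hs : entGap (y₁ (Γ.head j)) (y₃ (Γ.head j)) (y₂ (Γ.head j)) = e (Γ.head j) := by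
      simp only [he, entGap]
      rw [add_right_comm (y₁ _) (y₃ _)]; ring
    rw [hs] at b
    simp only [gradX]
    have ht : entGap (y₁ (Γ.tail j)) (y₂ (Γ.tail j)) (y₃ (Γ.tail j)) = e (Γ.tail j) := rfl
    rw [ht] at a
    linarith
  simp only [reg]
  linarith

lemma lin_centroid (p : D → ℝ) (q : W → ℝ) (x₁ x₂ x₃ : D → ℝ) (y₁ y₂ y₃ : W → ℝ) :
    3 * lin p q (fun j => (x₁ j + x₂ j + x₃ j) / 3) (fun w => (y₁ w + y₂ w + y₃ w) / 3) =
      lin p q x₁ y₁ + lin p q x₂ y₂ + lin p q x₃ y₃ := by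
  simp only [lin, mul_div_assoc', mul_add, add_div, Finset.sum_add_distrib, ← Finset.sum_div]
  ring

/-- One step of dual extrapolation with approximate minimizers. -/
lemma extrapolation_step {dl L δ : ℝ} (hd : ∀ w, Γ.deg w ≤ dl) (hL : 840 * dl ≤ L)
    {p : D → ℝ} {q : W → ℝ} {x₁ x₂ x₃ : D → ℝ} {y₁ y₂ y₃ : W → ℝ}
    (h₁ : Γ.Feas x₁ y₁) (h₂ : Γ.Feas x₂ y₂) (h₃ : Γ.Feas x₃ y₃)
    (hz : ∀ x y, Γ.Feas x y → Γ.obj L p q x₁ y₁ ≤ Γ.obj L p q x y + δ)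
    (hw : ∀ x y, Γ.Feas x y →
      Γ.obj L (fun j => p j + 2 * Γ.gradX y₁ j) (fun w => q w + 2 * Γ.gradY x₁ w) x₂ y₂ ≤
      Γ.obj L (fun j => p j + 2 * Γ.gradX y₁ j) (fun w => q w + 2 * Γ.gradY x₁ w) x y + δ) :
    Γ.obj L p q x₁ y₁ + (Γ.payoff x₂ y₃ - Γ.payoff x₃ y₂) ≤ Γ.obj L p q x₃ y₃ + 2 * δ := by
  -- Three times the near-optimality of point 1 at the centroid, with area convexity, bounds twice
  -- its objective by those of points 2 and 3 minus twice the area, up to `3 * δ`. Optimality of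
  -- point 2 for the shifted functional exchanges its objective for that of point 3 at cost `δ`.
  -- Bilinearity combines the area with the gradient terms into the payoff gap.
  have hc := hz _ _ (h₁.centroid h₂ h₃)
  have hw3 := hw _ _ h₃
  rw [obj_add, obj_add, lin_grad h₁.anti, lin_grad h₁.anti] at hw3
  have hA := reg_area_convex hd hL h₁ h₂ h₃
  have hl := lin_centroid p q x₁ x₂ x₃ y₁ y₂ y₃
  have e : ∑ j, ((x₂ j - x₁ j) * (Γ.gradX y₃ j - Γ.gradX y₁ j)
        - (x₃ j - x₁ j) * (Γ.gradX y₂ j - Γ.gradX y₁ j)) =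
      (Γ.payoff x₂ y₃ - Γ.payoff x₃ y₂) - (Γ.payoff x₂ y₁ - Γ.payoff x₃ y₁)
        - (Γ.payoff x₁ y₃ - Γ.payoff x₁ y₂) := by
    have : ∀ x y, ∑ j, x j * Γ.gradX y j = Γ.payoff x y - ∑ w, 2 * Γ.deg w * y w := by
      intro x y; simp only [payoff, gradX]; ring
    simp only [sub_mul, mul_sub, Finset.sum_sub_distrib, this]
    ring
  simp only [obj] at *
  linarith


variable {D W : Type} [Fintype D] [Fintype W] [DecidableEq W] (Γ : DartGraph D W)

/-! ### Alternating minimization -/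

/-- The best response in the box. -/
def xOpt (p : D → ℝ) (y : W → ℝ) (j : D) : ℝ :=
  max (-1) (min 1 (-p j / (2 * (y (Γ.tail j) + y (Γ.head j)))))

/-- The unnormalized best response in the simplex. -/
def yRaw (L : ℝ) (q : W → ℝ) (x : D → ℝ) (w : W) : ℝ :=
  Real.exp (-(q w + 2 * Γ.outSum (fun j => x j ^ 2) w) / L)

/-- The best response in the simplex. -/
def yOpt (L : ℝ) (q : W → ℝ) (x : D → ℝ) (w : W) : ℝ :=
  Γ.yRaw L q x w / ∑ v, Γ.yRaw L q x v

/-- The simplex iterates of alternating minimization, started from the all-ones vector. -/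
def altY (L : ℝ) (p : D → ℝ) (q : W → ℝ) : ℕ → W → ℝ
  | 0 => fun _ => 1
  | k + 1 => Γ.yOpt L q (Γ.xOpt p (altY L p q k))

/-- The box iterates of alternating minimization. -/
def altX (L : ℝ) (p : D → ℝ) (q : W → ℝ) (k : ℕ) : D → ℝ := Γ.xOpt p (Γ.altY L p q k)

variable {Γ}

lemma xOpt_anti {p : D → ℝ} (hp : ∀ j, p (Γ.rev j) = -p j) (y : W → ℝ) (j : D) :
    Γ.xOpt p y (Γ.rev j) = -Γ.xOpt p y j := by
  unfold xOpt
  have : Γ.tail (Γ.rev j) = Γ.head j := rfl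
  rw [head_rev, hp, this, add_comm (y (Γ.head j)), neg_neg]
  generalize 2 * (y (Γ.tail j) + y (Γ.head j)) = s
  rw [neg_div]
  generalize p j / s = a
  rcases le_total a 1 with h | h <;> rcases le_total (-1) a with h' | h' <;>
    simp only [max_def, min_def] <;> split_ifs <;> linarith

lemma abs_xOpt_le (p : D → ℝ) (y : W → ℝ) (j : D) : |Γ.xOpt p y j| ≤ 1 := by
  unfold xOpt
  rw [abs_le]
  exact ⟨le_max_left _ _, max_le (by norm_num) (min_le_left _ _)⟩

/-- The clipped point minimizes `p * t + s * t ^ 2` over `[-1, 1]`, and this is its first-order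
optimality condition. -/
lemma clip_variational {p s x : ℝ} (hs : 0 < s) (hx : |x| ≤ 1) :
    0 ≤ (p + 2 * s * max (-1) (min 1 (-p / (2 * s)))) * (x - max (-1) (min 1 (-p / (2 * s)))) := by
  obtain ⟨h1, h2⟩ := abs_le.1 hx
  rcases le_total 1 (-p / (2 * s)) with h | h
  · rw [min_eq_left h, max_eq_right (by norm_num)]
    rw [le_div_iff₀ (by positivity)] at h
    nlinarith
  · rw [min_eq_right h]
    rcases le_total (-1) (-p / (2 * s)) with h' | h'
    · rw [max_eq_right h']
      have : p + 2 * s * (-p / (2 * s)) = 0 := by field_simp; ring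
      rw [this, zero_mul]
    · rw [max_eq_left h']
      rw [div_le_iff₀ (by positivity)] at h'
      apply mul_nonneg <;> linarith

lemma yRaw_pos (L : ℝ) (q : W → ℝ) (x : D → ℝ) (w : W) : 0 < Γ.yRaw L q x w := Real.exp_pos _

lemma sum_yRaw_pos [Nonempty W] (L : ℝ) (q : W → ℝ) (x : D → ℝ) : 0 < ∑ v, Γ.yRaw L q x v :=
  Finset.sum_pos (fun _ _ => yRaw_pos L q x _) Finset.univ_nonempty

lemma yOpt_pos [Nonempty W] (L : ℝ) (q : W → ℝ) (x : D → ℝ) (w : W) : 0 < Γ.yOpt L q x w :=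
  div_pos (yRaw_pos L q x w) (sum_yRaw_pos L q x)

lemma sum_yOpt [Nonempty W] (L : ℝ) (q : W → ℝ) (x : D → ℝ) : ∑ w, Γ.yOpt L q x w = 1 := by
  unfold yOpt
  rw [← Finset.sum_div, div_self (sum_yRaw_pos L q x).ne']

lemma altY_pos [Nonempty W] (L : ℝ) (p : D → ℝ) (q : W → ℝ) (k : ℕ) (w : W) :
    0 < Γ.altY L p q k w := by
  cases k with
  | zero => exact one_pos
  | succ k => exact yOpt_pos _ _ _ _

lemma alt_feas [Nonempty W] (L : ℝ) {p : D → ℝ} (hp : ∀ j, p (Γ.rev j) = -p j) (q : W → ℝ) {k k' : ℕ}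
    (hk : k' ≠ 0) : Γ.Feas (Γ.altX L p q k) (Γ.altY L p q k') where
  anti := xOpt_anti hp _
  box := abs_xOpt_le _ _
  nonneg w := (altY_pos L p q k' w).le
  sum_one := by
    obtain ⟨m, rfl⟩ := Nat.exists_eq_succ_of_ne_zero hk
    exact sum_yOpt _ _ _

/-- The generalized relative entropy. -/
def kl (y y' : W → ℝ) : ℝ := ∑ w, klTerm (y w) (y' w)

lemma kl_nonneg {y y' : W → ℝ} (hy : ∀ w, 0 ≤ y w) (hy' : ∀ w, 0 < y' w) : 0 ≤ kl y y' :=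
  Finset.sum_nonneg fun w _ => klTerm_nonneg (hy w) (hy' w)

lemma kl_self (y : W → ℝ) : kl y y = 0 := by simp [kl, klTerm_self]

/-- A best response in the box is nearly optimal for nearby points of the simplex. -/
lemma obj_xOpt_le {dl : ℝ} (hd : ∀ w, Γ.deg w ≤ dl) (L : ℝ) (p : D → ℝ) (q : W → ℝ)
    {x : D → ℝ} {y y' : W → ℝ} (hx : ∀ j, |x j| ≤ 1) (hy : ∀ w, 0 ≤ y w) (hy' : ∀ w, 0 < y' w) :
    Γ.obj L p q (Γ.xOpt p y') y ≤ Γ.obj L p q x y + 32 * dl * kl y y' := by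
  have h1 := Γ.sum_tail_add_head_le hd (F := fun w => klTerm (y w) (y' w))
    fun w => klTerm_nonneg (hy w) (hy' w)
  have h2 : ∑ j, (p j * Γ.xOpt p y' j
      + (y (Γ.tail j) + y (Γ.head j)) * Γ.xOpt p y' j ^ 2) ≤
      ∑ j, (p j * x j + (y (Γ.tail j) + y (Γ.head j)) * x j ^ 2)
      + 16 * ∑ j, (klTerm (y (Γ.tail j)) (y' (Γ.tail j))
          + klTerm (y (Γ.head j)) (y' (Γ.head j))) := by
    rw [Finset.mul_sum, ← Finset.sum_add_distrib]
    refine Finset.sum_le_sum fun j _ => ?_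
    -- With `X` the clipped point and `s`, `s'` the weights from `y`, `y'`, the increase from `X` to
    -- `x` is this variational term plus `2 (s - s') X (x - X) + s (x - X)^2`, whose negative part
    -- `shift_le_klTerm` bounds at each end.
    have hv := clip_variational (p := p j) (s := y' (Γ.tail j) + y' (Γ.head j))
      (add_pos (hy' _) (hy' _)) (hx j)
    change 0 ≤ (p j + 2 * (y' (Γ.tail j) + y' (Γ.head j)) * Γ.xOpt p y' j)
      * (x j - Γ.xOpt p y' j) at hv
    have hb := abs_xOpt_le (Γ := Γ) p y' j
    have hd : |x j - Γ.xOpt p y' j| ≤ 2 := by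
      have a := abs_le.1 (hx j)
      have b := abs_le.1 hb
      rw [abs_le]; constructor <;> linarith
    have a := shift_le_klTerm (hy (Γ.tail j)) (hy' (Γ.tail j)) hb hd
    have b := shift_le_klTerm (hy (Γ.head j)) (hy' (Γ.head j)) hb hd
    nlinarith
  simp only [Finset.sum_add_distrib] at h2
  simp only [obj, lin, reg, kl]
  simp only [Finset.sum_add_distrib] at h1
  linarith

/-- The case `y' = y` of `obj_xOpt_le`, where the relative entropy vanishes; hence any degree bound
will do, here the sum of all degrees. -/
lemma obj_xOpt_le_self {L : ℝ} (p : D → ℝ) (q : W → ℝ)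
    {x : D → ℝ} {y : W → ℝ} (hx : ∀ j, |x j| ≤ 1) (hy : ∀ w, 0 < y w) :
    Γ.obj L p q (Γ.xOpt p y) y ≤ Γ.obj L p q x y := by
  have h := obj_xOpt_le (Γ := Γ) (dl := ∑ w, |Γ.deg w|) (fun w => (le_abs_self _).trans
    (Finset.single_le_sum (f := fun w => |Γ.deg w|) (fun _ _ => abs_nonneg _)
      (Finset.mem_univ w))) L p q hx (fun w => (hy w).le) hy
  rwa [kl_self, mul_zero, add_zero] at h

/-- The three-point identity for the best response in the simplex. -/
lemma obj_yOpt [Nonempty W] {L : ℝ} (hL : 0 < L) (p : D → ℝ) (q : W → ℝ) {x : D → ℝ} {y : W → ℝ}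
    (h : Γ.Feas x y) :
    Γ.obj L p q x (Γ.yOpt L q x) + L * kl y (Γ.yOpt L q x) = Γ.obj L p q x y := by
  set Z := ∑ v, Γ.yRaw L q x v with hZ
  have hZ0 : 0 < Z := sum_yRaw_pos L q x
  have hlog : ∀ w, L * Real.log (Γ.yOpt L q x w)
      = -(q w + 2 * Γ.outSum (fun j => x j ^ 2) w) - L * Real.log Z := by
    intro w
    rw [yOpt, Real.log_div (yRaw_pos L q x w).ne' hZ0.ne', yRaw, Real.log_exp]
    field_simp
  -- On the simplex the objective is a constant plus `L` times the relative entropy to the softmax.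
  have hf : ∀ y' : W → ℝ, ∑ w, y' w = 1 → Γ.obj L p q x y' = ∑ j, p j * x j - L * Real.log Z
      + L * ∑ w, y' w * (Real.log (y' w) - Real.log (Γ.yOpt L q x w)) := by
    intro y' hy'
    have : L * ∑ w, y' w * (Real.log (y' w) - Real.log (Γ.yOpt L q x w)) =
        L * (∑ w, y' w * Real.log (y' w)) + (∑ w, q w * y' w)
        + (∑ w, 2 * Γ.outSum (fun j => x j ^ 2) w * y' w) + L * Real.log Z * ∑ w, y' w := by
      simp only [Finset.mul_sum, ← Finset.sum_add_distrib]
      refine Finset.sum_congr rfl fun w _ => ?_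
      linear_combination -(y' w) * hlog w
    rw [this, hy', obj, lin, reg, Feas.sum_sq h.anti]
    ring
  rw [hf _ (sum_yOpt L q x), hf y h.sum_one]
  have : kl y (Γ.yOpt L q x)
      = ∑ w, y w * (Real.log (y w) - Real.log (Γ.yOpt L q x w)) := by
    simp only [kl, klTerm, Finset.sum_add_distrib, Finset.sum_sub_distrib, mul_sub, h.sum_one,
      sum_yOpt]
    ring
  rw [this]
  simp

/-- Linear convergence of alternating minimization. -/
lemma alt_converges [Nonempty W] {dl L : ℝ} (hd : ∀ w, Γ.deg w ≤ dl) (hL : 64 * dl ≤ L) (hL0 : 0 < L)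
    {p : D → ℝ} (hp : ∀ j, p (Γ.rev j) = -p j) (q : W → ℝ) {K : ℕ} (hK : K ≠ 0)
    {x : D → ℝ} {y : W → ℝ} (h : Γ.Feas x y) :
    Γ.obj L p q (Γ.altX L p q K) (Γ.altY L p q K) ≤
      Γ.obj L p q x y + L * Fintype.card W / 2 ^ K := by
  set X := Γ.altX L p q with hX
  set Y := Γ.altY L p q with hY
  have hYs : ∀ k, Y (k + 1) = Γ.yOpt L q (X k) := fun k => rfl
  have hXs : ∀ k, X k = Γ.xOpt p (Y k) := fun k => rfl
  have hXb : ∀ k j, |X k j| ≤ 1 := fun k => abs_xOpt_le _ _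
  have hXa : ∀ k j, X k (Γ.rev j) = -X k j := fun k => xOpt_anti hp _
  have hY0 : ∀ k w, 0 < Y k w := fun k => altY_pos L p q k
  have hle : ∀ k, Γ.obj L p q (X (k + 1)) (Y (k + 1)) ≤ Γ.obj L p q (X k) (Y (k + 1)) :=
    fun k => obj_xOpt_le_self p q (hXb k) (hY0 (k + 1))
  have hmono : ∀ k, Γ.obj L p q (X (k + 2)) (Y (k + 2)) ≤ Γ.obj L p q (X (k + 1)) (Y (k + 1)) := by
    intro k
    have h1 := obj_yOpt hL0 p q (alt_feas L hp q (k := k + 1) (k' := k + 1) k.succ_ne_zero)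
    have h2 := mul_nonneg hL0.le (kl_nonneg (y := Y (k + 1)) (y' := Y (k + 2))
      (fun w => (hY0 (k + 1) w).le) (hY0 (k + 2)))
    have h3 := hle (k + 1)
    change Γ.obj L p q (X (k + 1)) (Y (k + 2)) + L * kl (Y (k + 1)) (Y (k + 2))
      = Γ.obj L p q (X (k + 1)) (Y (k + 1)) at h1
    linarith
  -- The three-point identity produces the new relative entropy with weight `L`; using `X k` instead
  -- of `x` costs at most `32 * dl`, hence `L / 2`, times the old one.
  have hstep : ∀ k, Γ.obj L p q (X (k + 1)) (Y (k + 1)) + L * kl y (Y (k + 1)) ≤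
      Γ.obj L p q x y + L / 2 * kl y (Y k) := by
    intro k
    have h1 := obj_yOpt hL0 p q (x := X k) (y := y) ⟨hXa k, hXb k, h.nonneg, h.sum_one⟩
    have h2 := obj_xOpt_le hd L p q h.box h.nonneg (hY0 k)
    rw [← hXs] at h2
    have h3 := kl_nonneg h.nonneg (hY0 k)
    have h4 := hle k
    rw [← hYs] at h1
    nlinarith
  -- The start `Y 0` is not normalized. It enters only through `kl`, which is defined for
  -- unnormalized vectors.
  have hkl0 : kl y (Y 0) ≤ Fintype.card W := by
    have : (Fintype.card W : ℝ) = ∑ w : W, (1 : ℝ) := by simp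
    rw [kl, this]
    refine Finset.sum_le_sum fun w _ => ?_
    have hw1 : y w ≤ 1 := h.sum_one ▸ Finset.single_le_sum (fun v _ => h.nonneg v) (Finset.mem_univ w)
    have hl := mul_nonpos_of_nonneg_of_nonpos (h.nonneg w)
      (Real.log_nonpos (h.nonneg w) hw1)
    have h0 : Y 0 w = 1 := rfl
    rw [klTerm, h0, Real.log_one]
    linarith [h.nonneg w]
  -- If the bound fails then, by monotonicity, every earlier iterate also lies above the target
  -- value. So `hstep` halves the relative entropy in each round, and its last instance gives the
  -- bound after all.
  by_contra hcon
  have hpos : ∀ k, k + 1 ≤ K → 0 ≤ Γ.obj L p q (X (k + 1)) (Y (k + 1)) - Γ.obj L p q x y := by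
    intro k hk
    have hm : Antitone fun k => Γ.obj L p q (X (k + 1)) (Y (k + 1)) := antitone_nat_of_succ_le hmono
    obtain ⟨m, rfl⟩ := Nat.exists_eq_succ_of_ne_zero hK
    have := hm (show k ≤ m by omega)
    have h0 : 0 ≤ L * (Fintype.card W : ℝ) / 2 ^ (m + 1) := by positivity
    simp only [Nat.succ_eq_add_one] at hcon this
    linarith
  have hind : ∀ k, k ≤ K → 2 ^ k * (L * kl y (Y k)) ≤ L * kl y (Y 0) := by
    intro k
    induction k with
    | zero => intro; simp
    | succ k ih =>
      intro hk
      have h1 := hpos k hk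
      have h2 := hstep k
      have h3 := ih (by omega)
      have h4 : (0 : ℝ) < 2 ^ k := by positivity
      have h5 : 2 ^ k * (L * kl y (Y (k + 1))) ≤ 2 ^ k * (L / 2 * kl y (Y k)) :=
        mul_le_mul_of_nonneg_left (by linarith) h4.le
      rw [pow_succ]; linarith
  obtain ⟨m, rfl⟩ : ∃ m, K = m + 1 := ⟨K - 1, by omega⟩
  have h1 := hstep m
  have h2 := hind m (by omega)
  have h3 : 0 ≤ L * kl y (Y (m + 1)) := mul_nonneg hL0.le (kl_nonneg h.nonneg (hY0 (m + 1)))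
  apply hcon
  have h4 : (0 : ℝ) < 2 ^ m := by positivity
  have h5 : L / 2 * kl y (Y m) ≤ L * Fintype.card W / 2 ^ (m + 1) := by
    rw [le_div_iff₀ (by positivity), pow_succ]
    have := mul_le_mul_of_nonneg_left hkl0 hL0.le
    linarith
  exact le_trans ((le_add_of_nonneg_right h3).trans h1) (add_le_add le_rfl h5)

/-! ### Dual extrapolation -/

variable (Γ)

/-- The state of dual extrapolation: accumulated gradients and accumulated simplex iterates. -/
structure State (D W : Type) where
  p : D → ℝ
  q : W → ℝ
  acc : W → ℝ

/-- The gradient in the box variable, shifted by the first half-step of dual extrapolation. -/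
def shiftP (L : ℝ) (K : ℕ) (s : State D W) (j : D) : ℝ :=
  s.p j + 2 * Γ.gradX (Γ.altY L s.p s.q K) j

/-- The shifted gradient in the simplex variable. -/
def shiftQ (L : ℝ) (K : ℕ) (s : State D W) (w : W) : ℝ :=
  s.q w + 2 * Γ.gradY (Γ.altX L s.p s.q K) w

/-- The box iterate of dual extrapolation. -/
def iterX (L : ℝ) (K : ℕ) (s : State D W) : D → ℝ :=
  Γ.altX L (Γ.shiftP L K s) (Γ.shiftQ L K s) K

/-- The simplex iterate of dual extrapolation. -/
def iterY (L : ℝ) (K : ℕ) (s : State D W) : W → ℝ :=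
  Γ.altY L (Γ.shiftP L K s) (Γ.shiftQ L K s) K

/-- A step of dual extrapolation. -/
def step (L : ℝ) (K : ℕ) (s : State D W) : State D W where
  -- The factor 1 puts the update in the form of `obj_add`.
  p j := s.p j + 1 * Γ.gradX (Γ.iterY L K s) j
  q w := s.q w + 1 * Γ.gradY (Γ.iterX L K s) w
  acc w := s.acc w + Γ.iterY L K s w

/-- The states of dual extrapolation. -/
def state (L : ℝ) (K : ℕ) : ℕ → State D W
  | 0 => ⟨fun _ => 0, fun _ => 0, fun _ => 0⟩
  | t + 1 => Γ.step L K (state L K t)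

variable {Γ}

lemma gradX_anti (y : W → ℝ) (j : D) : Γ.gradX y (Γ.rev j) = -Γ.gradX y j := by
  rw [gradX, gradX, head_rev, neg_sub]; rfl

lemma state_anti (L : ℝ) (K t : ℕ) (j : D) :
    (Γ.state L K t).p (Γ.rev j) = -(Γ.state L K t).p j := by
  induction t with
  | zero => simp [state]
  | succ t ih => simp only [state, step, gradX_anti, ih]; ring

lemma shiftP_anti (L : ℝ) (K : ℕ) {s : State D W} (hs : ∀ j, s.p (Γ.rev j) = -s.p j) (j : D) :
    Γ.shiftP L K s (Γ.rev j) = -Γ.shiftP L K s j := by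
  simp only [shiftP, gradX_anti, hs]; ring

lemma iter_feas [Nonempty W] (L : ℝ) {K : ℕ} (hK : K ≠ 0) (t : ℕ) :
    Γ.Feas (Γ.iterX L K (Γ.state L K t)) (Γ.iterY L K (Γ.state L K t)) :=
  alt_feas L (shiftP_anti L K (state_anti L K t)) _ hK

lemma acc_eq (L : ℝ) (K t : ℕ) (w : W) :
    (Γ.state L K t).acc w = ∑ i ∈ Finset.range t, Γ.iterY L K (Γ.state L K i) w := by
  induction t with
  | zero => simp [state]
  | succ t ih => rw [Finset.sum_range_succ, ← ih]; rfl

/-- The entropy term is nonpositive and `x j ^ 2 ≤ 1`. Together with `le_reg` this bounds the range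
of the regularizer, the main term of the regret. -/
lemma reg_le {dl L : ℝ} (hd : ∀ w, Γ.deg w ≤ dl) (hL0 : 0 ≤ L)
    {x : D → ℝ} {y : W → ℝ} (h : Γ.Feas x y) : Γ.reg L x y ≤ 2 * dl := by
  have h1 := Γ.sum_tail_add_head_le hd h.nonneg
  rw [h.sum_one] at h1
  have h2 : ∑ j, (y (Γ.tail j) + y (Γ.head j)) * x j ^ 2 ≤ ∑ j, (y (Γ.tail j) + y (Γ.head j)) := by
    refine Finset.sum_le_sum fun j _ => mul_le_of_le_one_right
      (add_nonneg (h.nonneg _) (h.nonneg _)) ?_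
    rw [sq_le_one_iff_abs_le_one]; exact h.box j
  have h3 : ∑ w, y w * Real.log (y w) ≤ 0 := Finset.sum_nonpos fun w _ =>
    mul_nonpos_of_nonneg_of_nonpos (h.nonneg w) (Real.log_nonpos (h.nonneg w)
      (h.sum_one ▸ Finset.single_le_sum (fun v _ => h.nonneg v) (Finset.mem_univ w)))
  have := mul_nonpos_of_nonneg_of_nonpos hL0 h3
  unfold reg
  linarith

/-- Relative entropy to the uniform distribution is nonnegative. -/
lemma le_reg [Nonempty W] {L : ℝ} (hL0 : 0 ≤ L)
    {x : D → ℝ} {y : W → ℝ} (h : Γ.Feas x y) :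
    -(L * Real.log (Fintype.card W)) ≤ Γ.reg L x y := by
  have hN : (0 : ℝ) < Fintype.card W := by exact_mod_cast Fintype.card_pos
  have h1 := kl_nonneg (y' := fun _ : W => 1 / (Fintype.card W : ℝ)) h.nonneg
    (fun _ => by positivity)
  have h2 : kl y (fun _ : W => 1 / (Fintype.card W : ℝ))
      = ∑ w, y w * Real.log (y w) + Real.log (Fintype.card W) := by
    simp only [kl, klTerm, Finset.sum_add_distrib, Finset.sum_sub_distrib, h.sum_one,
      ← Finset.sum_mul, Finset.sum_const, Finset.card_univ, nsmul_eq_mul]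
    rw [mul_one_div_cancel hN.ne', one_div, Real.log_inv]
    ring
  have h3 : 0 ≤ ∑ j, (y (Γ.tail j) + y (Γ.head j)) * x j ^ 2 := Finset.sum_nonneg fun j _ =>
    mul_nonneg (add_nonneg (h.nonneg _) (h.nonneg _)) (sq_nonneg _)
  have := mul_nonneg hL0 (h2 ▸ h1)
  unfold reg
  linarith

/-- The regret bound of dual extrapolation. -/
lemma regret_le [Nonempty W] {dl L δ : ℝ} (hd : ∀ w, Γ.deg w ≤ dl) (hdl : 0 < dl)
    (hL : 840 * dl ≤ L) {K : ℕ} (hK : K ≠ 0) (hδ : L * Fintype.card W / 2 ^ K ≤ δ) (T : ℕ)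
    {x : D → ℝ} {y : W → ℝ} (h : Γ.Feas x y) :
    ∑ i ∈ Finset.range T, (Γ.payoff (Γ.iterX L K (Γ.state L K i)) y
        - Γ.payoff x (Γ.iterY L K (Γ.state L K i))) ≤
      2 * dl + L * Real.log (Fintype.card W) + 2 * T * δ := by
  have hL0 : 0 < L := by linarith
  set s := Γ.state L K with hs
  set zx := fun t => Γ.altX L (s t).p (s t).q K with hzx
  set zy := fun t => Γ.altY L (s t).p (s t).q K with hzy
  have hz : ∀ t, Γ.Feas (zx t) (zy t) := fun t => alt_feas L (state_anti L K t) _ hK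
  have hopt : ∀ t x y, Γ.Feas x y → Γ.obj L (s t).p (s t).q (zx t) (zy t) ≤
      Γ.obj L (s t).p (s t).q x y + δ := fun t x y h =>
    (alt_converges hd (by linarith) hL0 (state_anti L K t) _ hK h).trans (by linarith)
  set c := fun t => ∑ w, 2 * Γ.deg w * Γ.iterY L K (s t) w with hc
  have hstep : ∀ t x y, Γ.Feas x y → Γ.obj L (s t).p (s t).q (zx t) (zy t)
      + (Γ.payoff (Γ.iterX L K (s t)) y - Γ.payoff x (Γ.iterY L K (s t))) ≤
      Γ.obj L (s t).p (s t).q x y + 2 * δ := by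
    intro t x y h
    refine extrapolation_step hd hL (hz t) (iter_feas L hK t) h (hopt t) fun x y h => ?_
    exact (alt_converges hd (by linarith) hL0 (shiftP_anti L K (state_anti L K t)) _ hK h).trans
      (by gcongr; rfl)
  have hsucc : ∀ t x y, Γ.Feas x y → Γ.obj L (s (t + 1)).p (s (t + 1)).q x y =
      Γ.obj L (s t).p (s t).q x y - (Γ.payoff (Γ.iterX L K (s t)) y
        - Γ.payoff x (Γ.iterY L K (s t))) - c t := by
    intro t x y h
    have : Γ.obj L (s (t + 1)).p (s (t + 1)).q x y = _ :=
      obj_add L (s t).p (Γ.gradX (Γ.iterY L K (s t))) (s t).q (Γ.gradY (Γ.iterX L K (s t))) 1 x y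
    rw [this, lin_grad (iter_feas L hK t).anti]
    ring
  -- Induction with the next iterate as comparator in `hstep`: the payoff gap appearing there is
  -- exactly what `hsucc` subtracts from the next objective.
  have hlow : ∀ t, -(L * Real.log (Fintype.card W)) - 2 * t * δ - ∑ i ∈ Finset.range t, c i ≤
      Γ.obj L (s t).p (s t).q (zx t) (zy t) := by
    intro t
    induction t with
    | zero =>
      have := le_reg hL0.le (hz 0)
      simpa [obj, lin, hs, state] using this
    | succ t ih =>
      have h1 := hstep t _ _ (hz (t + 1))
      rw [hsucc t _ _ (hz (t + 1)), Finset.sum_range_succ]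
      push_cast
      linarith
  have hval : ∀ t, Γ.obj L (s t).p (s t).q x y = Γ.reg L x y
      - ∑ i ∈ Finset.range t, (Γ.payoff (Γ.iterX L K (s i)) y - Γ.payoff x (Γ.iterY L K (s i)))
      - ∑ i ∈ Finset.range t, c i := by
    intro t
    induction t with
    | zero => simp [obj, lin, hs, state]
    | succ t ih =>
      rw [hsucc t x y h, ih, Finset.sum_range_succ, Finset.sum_range_succ]
      ring
  have hr := reg_le hd hL0.le h
  rcases T with _ | t
  · have h1 := Real.log_nonneg (show (1 : ℝ) ≤ Fintype.card W by
      exact_mod_cast Fintype.card_pos)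
    have := mul_nonneg hL0.le h1
    simp only [Finset.range_zero, Finset.sum_empty, Nat.cast_zero]
    linarith
  -- One step with `(x, y)` itself as comparator; `hval` unfolds its objective into the accumulated
  -- gaps, and the sums of `c` cancel.
  · have h1 := hstep t x y h
    have h2 := hlow t
    rw [hval] at h1
    rw [Finset.sum_range_succ]
    push_cast
    linarith


/-! ### The value of the game and the average iterate -/

variable {D W : Type} [Fintype D] [Fintype W] [DecidableEq W] (Γ : DartGraph D W)

/-- The value of a simplex vector against the best response in the box, up to a factor `2`. -/
def minSum (y : W → ℝ) : ℝ := ∑ j, min (y (Γ.tail j)) (y (Γ.head j))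

variable {Γ}

/-- The term `2 * deg w * y w` is spread over the darts at `w` in both directions, so that each dart
contributes `(1 + x) y_tail + (1 - x) y_head`. -/
lemma payoff_eq (x : D → ℝ) (y : W → ℝ) : Γ.payoff x y =
    ∑ j, (y (Γ.tail j) + y (Γ.head j) + x j * (y (Γ.tail j) - y (Γ.head j))) := by
  rw [Finset.sum_add_distrib, Finset.sum_add_distrib, sum_head, sum_tail, payoff]
  congr 1
  rw [← Finset.sum_add_distrib]
  exact Finset.sum_congr rfl fun w _ => by ring

lemma two_minSum_le_payoff {x : D → ℝ} (hx : ∀ j, |x j| ≤ 1) (y : W → ℝ) :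
    2 * Γ.minSum y ≤ Γ.payoff x y := by
  rw [payoff_eq, minSum, Finset.mul_sum]
  refine Finset.sum_le_sum fun j _ => ?_
  obtain ⟨h1, h2⟩ := abs_le.1 (hx j)
  rcases le_total (y (Γ.tail j)) (y (Γ.head j)) with h | h
  · rw [min_eq_left h]; nlinarith
  · rw [min_eq_right h]; nlinarith

/-- Put all the weight of a dart on its smaller end. As the sign of a difference this choice is
antisymmetric, so restricting to antisymmetric vectors loses nothing. -/
lemma exists_payoff_eq (y : W → ℝ) : ∃ x : D → ℝ, (∀ j, x (Γ.rev j) = -x j) ∧ (∀ j, |x j| ≤ 1) ∧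
    Γ.payoff x y = 2 * Γ.minSum y := by
  refine ⟨fun j => SignType.sign (y (Γ.head j) - y (Γ.tail j)), fun j => ?_, fun j => ?_, ?_⟩
  · have : Γ.tail (Γ.rev j) = Γ.head j := rfl
    simp only [head_rev, this]
    rw [← neg_sub, Left.sign_neg]; simp
  · rcases lt_trichotomy (y (Γ.head j) - y (Γ.tail j)) 0 with h | h | h <;> simp [h]
  · rw [payoff_eq, minSum, Finset.mul_sum]
    refine Finset.sum_congr rfl fun j _ => ?_
    rcases lt_trichotomy (y (Γ.head j)) (y (Γ.tail j)) with h | h | h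
    · rw [sign_neg (by linarith), min_eq_right h.le]; simp; ring
    · rw [h]; simp; ring
    · rw [sign_pos (by linarith), min_eq_left h.le]; simp; ring

/-- The average simplex iterate is nearly optimal. -/
lemma minSum_le_average [Nonempty W] {dl L δ : ℝ} (hd : ∀ w, Γ.deg w ≤ dl) (hdl : 0 < dl)
    (hL : 840 * dl ≤ L) {K : ℕ} (hK : K ≠ 0) (hδ : L * Fintype.card W / 2 ^ K ≤ δ) (T : ℕ)
    {y : W → ℝ} (hy : ∀ w, 0 ≤ y w) (hy1 : ∑ w, y w = 1) :
    2 * T * Γ.minSum y ≤ 2 * Γ.minSum (Γ.state L K T).acc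
      + (2 * dl + L * Real.log (Fintype.card W) + 2 * T * δ) := by
  -- The comparator is the best response to the accumulated iterates; since the payoff is linear in
  -- `y`, the sum over the steps collapses.
  obtain ⟨x, hx, hb, he⟩ := Γ.exists_payoff_eq (Γ.state L K T).acc
  have h := regret_le hd hdl hL hK hδ T ⟨hx, hb, hy, hy1⟩
  have h1 : 2 * T * Γ.minSum y ≤
      ∑ i ∈ Finset.range T, Γ.payoff (Γ.iterX L K (Γ.state L K i)) y := by
    have := Finset.card_nsmul_le_sum (Finset.range T)
      (fun i => Γ.payoff (Γ.iterX L K (Γ.state L K i)) y) (2 * Γ.minSum y)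
      fun i _ => two_minSum_le_payoff (iter_feas L hK i).box y
    rw [Finset.card_range, nsmul_eq_mul] at this
    linarith
  have h2 : ∑ i ∈ Finset.range T, Γ.payoff x (Γ.iterY L K (Γ.state L K i)) =
      Γ.payoff x (Γ.state L K T).acc := by
    simp only [payoff_eq, acc_eq]
    rw [Finset.sum_comm]
    simp only [Finset.sum_add_distrib, Finset.sum_sub_distrib, Finset.mul_sum, mul_sub]
  rw [Finset.sum_sub_distrib, h2, he] at h
  linarith

lemma sum_acc [Nonempty W] (L : ℝ) {K : ℕ} (hK : K ≠ 0) (T : ℕ) :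
    ∑ w, (Γ.state L K T).acc w = T := by
  simp only [acc_eq]
  rw [Finset.sum_comm]
  simp [(iter_feas (Γ := Γ) L hK _).sum_one]

lemma acc_nonneg [Nonempty W] (L : ℝ) {K : ℕ} (hK : K ≠ 0) (T : ℕ) (w : W) :
    0 ≤ (Γ.state L K T).acc w := by
  rw [acc_eq]
  exact Finset.sum_nonneg fun i _ => (iter_feas L hK _).nonneg w

end DartGraph

/-! ### Densities and fractional cuts -/

section Density

variable {n : ℕ} (G : SimpleGraph (Fin n)) [DecidableRel G.Adj]

/-- Every edge carries exactly two darts: densities count edges, the game counts darts. -/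
lemma card_darts_inside (S : Finset (Fin n)) :
    (Finset.univ.filter fun d : G.Dart => d.fst ∈ S ∧ d.snd ∈ S).card =
      2 * (G.edgeFinset.filter fun e => ∀ v ∈ e, v ∈ S).card := by
  rw [Finset.card_eq_sum_card_fiberwise (f := fun d : G.Dart => d.edge)
    (t := G.edgeFinset.filter fun e => ∀ v ∈ e, v ∈ S), mul_comm, ← smul_eq_mul,
    ← Finset.sum_const]
  · refine Finset.sum_congr rfl fun e he => ?_
    rw [Finset.mem_filter, SimpleGraph.mem_edgeFinset] at he
    rw [← G.dart_edge_fiber_card e he.1]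
    congr 1
    ext d
    simp only [Finset.mem_filter, Finset.mem_univ, true_and]
    refine ⟨fun h => h.2, fun h => ⟨?_, h⟩⟩
    have h2 := he.2
    rw [← h] at h2
    exact ⟨h2 _ (Sym2.mem_mk_left _ _), h2 _ (Sym2.mem_mk_right _ _)⟩
  · intro d hd
    simp only [Finset.coe_filter, Finset.mem_univ, true_and, Set.mem_ofPred_eq] at hd ⊢
    refine ⟨SimpleGraph.mem_edgeFinset.2 d.edge_mem, fun v hv => ?_⟩
    rcases Sym2.mem_iff.1 hv with rfl | rfl
    exacts [hd.1, hd.2]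

lemma subgraphDensity_le_max {S : Finset (Fin n)} (hS : S.Nonempty) :
    subgraphDensity G S ≤ maxSubgraphDensity G :=
  le_ciSup (f := fun S : {S : Finset (Fin n) // S.Nonempty} => subgraphDensity G S.1)
    (Set.finite_range _).bddAbove ⟨S, hS⟩

lemma card_darts_inside_le (S : Finset (Fin n)) :
    ((Finset.univ.filter fun d : G.Dart => d.fst ∈ S ∧ d.snd ∈ S).card : ℝ) ≤
      2 * maxSubgraphDensity G * S.card := by
  rw [card_darts_inside]
  rcases S.eq_empty_or_nonempty with rfl | hS
  · have : (G.edgeFinset.filter fun e => ∀ v ∈ e, v ∈ (∅ : Finset (Fin n))) = ∅ := by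
      refine Finset.filter_false_of_mem fun e _ h => ?_
      induction e with
      | _ a b => simpa using h a (Sym2.mem_mk_left _ _)
    simp only [this, Finset.card_empty]
    simp
  · have h := subgraphDensity_le_max G hS
    have hc : (0 : ℝ) < S.card := by exact_mod_cast hS.card_pos
    rw [subgraphDensity, div_le_iff₀ hc] at h
    push_cast
    linarith

/-- The layer-cake bound: fractional cuts are averages of vertex sets. -/
lemma sum_min_le (y : Fin n → ℝ) (hy : ∀ v, 0 ≤ y v) :
    ∑ d : G.Dart, min (y d.fst) (y d.snd) ≤ 2 * maxSubgraphDensity G * ∑ v, y v := by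
  induction h : (Finset.univ.filter fun v => y v ≠ 0).card using Nat.strong_induction_on
    generalizing y with
  | _ N ih =>
    set S := Finset.univ.filter fun v => y v ≠ 0 with hS
    have hnot : ∀ v, v ∉ S → y v = 0 := fun v hv => by simpa [hS] using hv
    rcases S.eq_empty_or_nonempty with h0 | hne
    · have : y = fun _ => 0 := funext fun v => hnot v (by simp [h0])
      simp [this]
    -- Subtract the least positive value on the support `S`. Every dart inside `S` loses exactly
    -- this value, every other dart has minimum zero before and after, and the support shrinks.
    obtain ⟨a, haS, ha⟩ := Finset.exists_min_image S y hne
    have ha0 : 0 ≤ y a := hy a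
    set z : Fin n → ℝ := fun v => if v ∈ S then y v - y a else 0 with hz
    have hz0 : ∀ v, 0 ≤ z v := by
      intro v
      simp only [hz]
      split_ifs with hv
      · have := ha v hv; linarith
      · exact le_rfl
    have hlt : (Finset.univ.filter fun v => z v ≠ 0).card < N := by
      rw [← h]
      refine Finset.card_lt_card ⟨fun v hv => ?_, fun hsub => ?_⟩
      · by_contra hv'
        simp [hz, hv'] at hv
      · have := hsub haS
        simp [hz] at this
    have hi := ih _ hlt z hz0 rfl
    have h1 : ∑ v, y v = ∑ v, z v + y a * S.card := by
      have : ∀ v, y v = z v + if v ∈ S then y a else 0 := by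
        intro v
        simp only [hz]
        split_ifs with hv
        · ring
        · rw [hnot v hv]; simp
      conv_lhs => rw [Finset.sum_congr rfl fun v _ => this v]
      rw [Finset.sum_add_distrib, ← Finset.sum_filter]
      simp [mul_comm]
    have h2 : ∑ d : G.Dart, min (y d.fst) (y d.snd) = ∑ d : G.Dart, min (z d.fst) (z d.snd)
        + y a * (Finset.univ.filter fun d : G.Dart => d.fst ∈ S ∧ d.snd ∈ S).card := by
      have : ∀ d : G.Dart, min (y d.fst) (y d.snd) = min (z d.fst) (z d.snd)
          + if d.fst ∈ S ∧ d.snd ∈ S then y a else 0 := by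
        intro d
        by_cases hf : d.fst ∈ S <;> by_cases hs : d.snd ∈ S
        · simp only [hz, hf, hs, and_self, if_true, min_sub_sub_right]; ring
        · simp [hz, hf, hs, hnot _ hs, hy, ha _ hf]
        · simp [hz, hf, hs, hnot _ hf, hy, ha _ hs]
        · simp [hz, hf, hs, hnot _ hf, hnot _ hs]
      conv_lhs => rw [Finset.sum_congr rfl fun v _ => this v]
      rw [Finset.sum_add_distrib, ← Finset.sum_filter]
      simp [mul_comm]
    have h3 := mul_le_mul_of_nonneg_left (card_darts_inside_le G S) ha0
    rw [h1, h2]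
    linarith

/-- The two ends of one edge. This lower bound is what makes an additive error relative. -/
lemma half_le_maxSubgraphDensity (hE : G.edgeFinset.Nonempty) : 1 / 2 ≤ maxSubgraphDensity G := by
  obtain ⟨e, he⟩ := hE
  induction e with
  | _ a b =>
    have hab : G.Adj a b := by simpa using he
    refine le_trans ?_ (subgraphDensity_le_max G (S := {a, b}) ⟨a, by simp⟩)
    rw [subgraphDensity, Finset.card_pair hab.ne]
    have : 1 ≤ (G.edgeFinset.filter fun e => ∀ v ∈ e, v ∈ ({a, b} : Finset (Fin n))).card := by
      rw [Nat.one_le_iff_ne_zero, ← Nat.pos_iff_ne_zero, Finset.card_pos]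
      exact ⟨s(a, b), by simp [hab]⟩
    have : (1 : ℝ) ≤ (G.edgeFinset.filter fun e => ∀ v ∈ e, v ∈ ({a, b} : Finset (Fin n))).card := by
      exact_mod_cast this
    push_cast
    linarith

end Density

/-! ### The darts of an adjacency array -/

namespace IsAdjacencyArray

variable {n : ℕ} {G : SimpleGraph (Fin n)} [DecidableRel G.Adj] {off adj : ℕ → ℕ}

lemma off_mono (hA : IsAdjacencyArray G off adj) {a b : ℕ} (hab : a ≤ b) (hb : b ≤ n) :
    off a ≤ off b := by
  induction b, hab using Nat.le_induction with
  | base => exact le_rfl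
  | succ b hab ih =>
    have := hA.off_succ ⟨b, by omega⟩
    simp only at this
    have := ih (by omega)
    omega

lemma off_eq_sum (hA : IsAdjacencyArray G off adj) : off n = ∑ v, G.degree v := by
  have h : ∀ k (hk : k ≤ n), off k = ∑ i : Fin k, G.degree ⟨i, by omega⟩ := by
    intro k
    induction k with
    | zero => intro; simp [hA.off_zero]
    | succ k ih =>
      intro hk
      have h1 := hA.off_succ ⟨k, by omega⟩
      simp only at h1
      rw [h1, ih (by omega), Fin.sum_univ_castSucc]
      rfl
  exact h n le_rfl

lemma off_eq (hA : IsAdjacencyArray G off adj) : off n = 2 * G.edgeFinset.card := by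
  rw [hA.off_eq_sum, G.sum_degrees_eq_twice_card_edges]

lemma exists_tail (hA : IsAdjacencyArray G off adj) {j : ℕ} (hj : j < off n) :
    ∃ v : Fin n, off v ≤ j ∧ j < off (v + 1) := by
  have h : ∀ k ≤ n, j < off k → ∃ v < k, off v ≤ j ∧ j < off (v + 1) := by
    intro k
    induction k with
    | zero => intro _ h; rw [hA.off_zero] at h; omega
    | succ k ih =>
      intro hk h
      by_cases h1 : j < off k
      · obtain ⟨v, hv, h2⟩ := ih (by omega) h1
        exact ⟨v, by omega, h2⟩
      · exact ⟨k, by omega, by omega, h⟩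
  obtain ⟨v, hv, h⟩ := h n le_rfl hj
  exact ⟨⟨v, hv⟩, h⟩

lemma tail_unique (hA : IsAdjacencyArray G off adj) {j a b : ℕ} (ha : a < n) (hb : b < n)
    (ha1 : off a ≤ j) (ha2 : j < off (a + 1)) (hb1 : off b ≤ j) (hb2 : j < off (b + 1)) :
    a = b := by
  by_contra h
  rcases lt_or_gt_of_ne h with h | h
  · have := hA.off_mono (show a + 1 ≤ b by omega) hb.le; omega
  · have := hA.off_mono (show b + 1 ≤ a by omega) ha.le; omega

variable (hA : IsAdjacencyArray G off adj)

/-- The dart at a position of the adjacency array. -/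
def dart (j : Fin (off n)) : G.Dart :=
  have h := (hA.exists_tail j.2).choose_spec
  have h2 := (hA.adj_bijOn (hA.exists_tail j.2).choose).mapsTo ⟨h.1, h.2⟩
  ⟨((hA.exists_tail j.2).choose, h2.choose), h2.choose_spec.1⟩

lemma off_fst_le (j : Fin (off n)) : off (hA.dart j).fst ≤ j :=
  (hA.exists_tail j.2).choose_spec.1

lemma lt_off_fst (j : Fin (off n)) : j < off ((hA.dart j).fst + 1) :=
  (hA.exists_tail j.2).choose_spec.2

lemma snd_eq (j : Fin (off n)) : ((hA.dart j).snd : ℕ) = adj j := by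
  have h := (hA.exists_tail j.2).choose_spec
  have h2 := (hA.adj_bijOn (hA.exists_tail j.2).choose).mapsTo ⟨h.1, h.2⟩
  exact h2.choose_spec.2

lemma dart_bijective : Function.Bijective hA.dart := by
  constructor
  · intro i j hij
    have hi := hA.off_fst_le i
    have hi' := hA.lt_off_fst i
    have hj := hA.off_fst_le j
    have hj' := hA.lt_off_fst j
    rw [← hij] at hj hj'
    have h := (hA.adj_bijOn (hA.dart i).fst).injOn ⟨hi, hi'⟩ ⟨hj, hj'⟩
      (by rw [← hA.snd_eq, ← hA.snd_eq, hij])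
    exact Fin.ext h
  · intro d
    obtain ⟨j, ⟨hj1, hj2⟩, hj⟩ := (hA.adj_bijOn d.fst).surjOn ⟨d.snd, d.adj, rfl⟩
    have hjn : j < off n := lt_of_lt_of_le hj2 (hA.off_mono (show (d.fst : ℕ) + 1 ≤ n by omega) le_rfl)
    refine ⟨⟨j, hjn⟩, ?_⟩
    have h1 : (hA.dart ⟨j, hjn⟩).fst = d.fst := Fin.ext (hA.tail_unique (by omega) (by omega)
      (hA.off_fst_le ⟨j, hjn⟩) (hA.lt_off_fst ⟨j, hjn⟩) hj1 hj2)
    have h2 : (hA.dart ⟨j, hjn⟩).snd = d.snd := Fin.ext ((hA.snd_eq ⟨j, hjn⟩).trans hj)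
    exact SimpleGraph.Dart.ext _ _ (Prod.ext h1 h2)

/-- The positions of the adjacency array are the darts of the graph. -/
def dartEquiv : Fin (off n) ≃ G.Dart := Equiv.ofBijective _ hA.dart_bijective

/-- The dart graph of an adjacency array, on the vertices that are not isolated. -/
def dartGraph : DartGraph (Fin (off n)) {v : Fin n // 0 < G.degree v} where
  tail j := ⟨(hA.dartEquiv j).fst, (G.degree_pos_iff_exists_adj _).2 ⟨_, (hA.dartEquiv j).adj⟩⟩
  rev j := hA.dartEquiv.symm (hA.dartEquiv j).symm
  rev_rev j := by simp

lemma tail_val (j : Fin (off n)) : (hA.dartGraph.tail j).1 = (hA.dart j).fst := rfl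

lemma head_val (j : Fin (off n)) : (hA.dartGraph.head j).1 = (hA.dart j).snd := by
  simp only [DartGraph.head, dartGraph, Equiv.apply_symm_apply]
  rfl

lemma tail_eq_iff (j : Fin (off n)) (w : {v : Fin n // 0 < G.degree v}) :
    hA.dartGraph.tail j = w ↔ off w.1 ≤ j ∧ (j : ℕ) < off (w.1 + 1) := by
  refine ⟨?_, fun h => ?_⟩
  · rintro rfl
    exact ⟨hA.off_fst_le j, hA.lt_off_fst j⟩
  · exact Subtype.ext (Fin.ext (hA.tail_unique (by omega) (by omega) (hA.off_fst_le j)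
      (hA.lt_off_fst j) h.1 h.2))

lemma off_lt_off_succ (hA : IsAdjacencyArray G off adj) (w : {v : Fin n // 0 < G.degree v}) : off w.1 < off (w.1 + 1) := by
  rw [hA.off_succ]; have := w.2; omega

lemma off_succ_le (hA : IsAdjacencyArray G off adj) (v : Fin n) : off (v + 1) ≤ off n := hA.off_mono (by omega) le_rfl

lemma off_lt (hA : IsAdjacencyArray G off adj) (w : {v : Fin n // 0 < G.degree v}) : off w.1 < off n :=
  (hA.off_lt_off_succ w).trans_le (hA.off_succ_le w.1)

/-- Every nonisolated vertex is the tail of its first dart. -/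
lemma tail_off (hA : IsAdjacencyArray G off adj) (w : {v : Fin n // 0 < G.degree v}) :
    hA.dartGraph.tail ⟨off w.1, hA.off_lt w⟩ = w :=
  (hA.tail_eq_iff _ w).2 ⟨le_rfl, hA.off_lt_off_succ w⟩

/-- The darts leaving a vertex occupy consecutive positions, so one array of prefix sums yields all
vertex sums. -/
lemma outSum_eq (a : ℕ → ℝ) (w : {v : Fin n // 0 < G.degree v}) :
    hA.dartGraph.outSum (fun j => a j) w =
      ∑ i ∈ Finset.range (off (w.1 + 1)), a i - ∑ i ∈ Finset.range (off w.1), a i := by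
  rw [← Finset.sum_Ico_eq_sub _ (hA.off_lt_off_succ w).le, DartGraph.outSum]
  refine Finset.sum_bij (fun j _ => (j : ℕ)) ?_ ?_ ?_ ?_
  · intro j hj
    rw [Finset.mem_filter, tail_eq_iff] at hj
    exact Finset.mem_Ico.2 hj.2
  · intro i _ j _ h; exact Fin.ext h
  · intro i hi
    rw [Finset.mem_Ico] at hi
    exact ⟨⟨i, hi.2.trans_le (hA.off_succ_le _)⟩, by simp [tail_eq_iff, hi], rfl⟩
  · intro j _; rfl

lemma deg_eq (w : {v : Fin n // 0 < G.degree v}) : hA.dartGraph.deg w = G.degree w.1 := by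
  have h := hA.outSum_eq (fun _ => 1) w
  rw [DartGraph.deg, h]
  simp [hA.off_succ]

/-- The value computed from a nonnegative vector is at most the maximum density. -/
lemma minSum_le {y : {v : Fin n // 0 < G.degree v} → ℝ} (hy : ∀ w, 0 ≤ y w) :
    hA.dartGraph.minSum y ≤ 2 * maxSubgraphDensity G * ∑ w, y w := by
  set z : Fin n → ℝ := fun v => if h : 0 < G.degree v then y ⟨v, h⟩ else 0 with hz
  have h := sum_min_le G z fun v => by simp only [hz]; split_ifs <;> simp [hy]
  have h1 : ∀ w : {v : Fin n // 0 < G.degree v}, z w.1 = y w := fun w => by simp [hz, w.2]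
  have h2 : hA.dartGraph.minSum y = ∑ d : G.Dart, min (z d.fst) (z d.snd) := by
    rw [← Equiv.sum_comp hA.dartEquiv, DartGraph.minSum]
    refine Finset.sum_congr rfl fun j _ => ?_
    rw [← h1, ← h1, head_val]; rfl
  have h3 : ∑ w, y w = ∑ v, z v := by
    rw [← Finset.sum_filter_of_ne (p := fun v => 0 < G.degree v)
      (fun v _ hv => by by_contra h0; simp [hz, h0] at hv),
      Finset.sum_subtype (p := fun v => 0 < G.degree v) _ (by simp)]
    exact Finset.sum_congr rfl fun w _ => (h1 w).symm
  rw [h2, h3]; exact h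

/-- The indicator vectors of vertex sets realize the densities. -/
lemma density_le {c : ℝ} (hc : 0 ≤ c) (h : ∀ y : {v : Fin n // 0 < G.degree v} → ℝ, (∀ w, 0 ≤ y w) →
    ∑ w, y w = 1 → hA.dartGraph.minSum y ≤ 2 * c) : maxSubgraphDensity G ≤ c := by
  refine Real.iSup_le ?_ hc
  rintro ⟨S, hS⟩
  simp only
  set m := (G.edgeFinset.filter fun e => ∀ v ∈ e, v ∈ S).card with hm
  -- Isolated vertices span no edges, so discarding them can only raise the density.
  set U : Finset {v : Fin n // 0 < G.degree v} := Finset.univ.filter fun w => w.1 ∈ S with hU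
  have hcard : U.card ≤ S.card :=
    Finset.card_le_card_of_injOn (fun w => w.1) (fun w hw => by simpa [hU] using hw)
      (fun a _ b _ h => Subtype.ext h)
  have hd := card_darts_inside G S
  rcases U.eq_empty_or_nonempty with h0 | hne
  · have : (Finset.univ.filter fun d : G.Dart => d.fst ∈ S ∧ d.snd ∈ S) = ∅ := by
      refine Finset.filter_false_of_mem fun d _ hd => ?_
      have : (⟨d.fst, (G.degree_pos_iff_exists_adj _).2 ⟨_, d.adj⟩⟩ :
        {v : Fin n // 0 < G.degree v}) ∈ U := by simp [hU, hd.1]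
      simp [h0] at this
    rw [this] at hd
    have : m = 0 := by rw [Finset.card_empty] at hd; omega
    simpa [subgraphDensity, ← hm, this] using hc
  · have hU0 : (0 : ℝ) < U.card := by exact_mod_cast hne.card_pos
    have hi := h (fun w => if w ∈ U then 1 / U.card else 0)
      (fun w => by split_ifs <;> positivity)
      (by rw [← Finset.sum_filter]; simp; field_simp)
    have he : hA.dartGraph.minSum (fun w => if w ∈ U then 1 / (U.card : ℝ) else 0) =
        (2 * m : ℕ) * (1 / U.card) := by
      rw [← hd, ← nsmul_eq_mul, ← Finset.sum_const, Finset.sum_filter, DartGraph.minSum,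
        ← Equiv.sum_comp hA.dartEquiv]
      refine Finset.sum_congr rfl fun j _ => ?_
      have h1 : hA.dartGraph.tail j ∈ U ↔ (hA.dartEquiv j).fst ∈ S := by
        simp [hU, tail_val, dartEquiv]
      have h2 : hA.dartGraph.head j ∈ U ↔ (hA.dartEquiv j).snd ∈ S := by
        simp [hU, head_val, dartEquiv]
      have h3 : 0 ≤ 1 / (U.card : ℝ) := by positivity
      by_cases a : (hA.dartEquiv j).fst ∈ S <;> by_cases b : (hA.dartEquiv j).snd ∈ S <;>
        simp only [h1, h2, a, b, and_self, and_true, and_false, if_true, if_false, min_self,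
          min_eq_left h3, min_eq_right h3]
    rw [he] at hi
    push_cast at hi
    have h1 : (m : ℝ) / U.card ≤ c := by
      rw [mul_one_div, mul_div_assoc] at hi; linarith
    rw [subgraphDensity, ← hm]
    refine le_trans ?_ h1
    exact div_le_div_of_nonneg_left (Nat.cast_nonneg _) hU0 (by exact_mod_cast hcard)

end IsAdjacencyArray

namespace PRAM

/-! ### Execution within a budget -/

/-- The memory with one array of natural numbers replaced. -/
def Mem.setN (σ : Mem) (a : ℕ) (f : ℕ → ℕ) : Mem := ⟨Function.update σ.nat a f, σ.real⟩

/-- The memory with one array of real numbers replaced. -/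
def Mem.setR (σ : Mem) (a : ℕ) (f : ℕ → ℝ) : Mem := ⟨σ.nat, Function.update σ.real a f⟩

@[simp] lemma Mem.setN_real (σ : Mem) (a : ℕ) (f : ℕ → ℕ) : (σ.setN a f).real = σ.real := rfl
@[simp] lemma Mem.setR_nat (σ : Mem) (a : ℕ) (f : ℕ → ℝ) : (σ.setR a f).nat = σ.nat := rfl
@[simp] lemma Mem.setN_nat (σ : Mem) (a : ℕ) (f : ℕ → ℕ) (b : ℕ) :
    (σ.setN a f).nat b = if b = a then f else σ.nat b := by
  simp only [Mem.setN, Function.update_apply]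
@[simp] lemma Mem.setR_real (σ : Mem) (a : ℕ) (f : ℕ → ℝ) (b : ℕ) :
    (σ.setR a f).real b = if b = a then f else σ.real b := by
  simp only [Mem.setR, Function.update_apply]

/-- The number of operations in the text of a program. -/
def Cmd.ops : Cmd → ℕ
  | .setN _ len idx val guard => len.ops + (guard.ops + idx.ops + val.ops + 1)
  | .setR _ len idx val guard => len.ops + (guard.ops + idx.ops + val.ops + 1)
  | .seq c₁ c₂ => c₁.ops + c₂.ops
  | .ite b c₁ c₂ => b.ops + c₁.ops + c₂.ops
  | .loop b c => b.ops + c.ops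

/-- The arrays of natural numbers that a program may write. -/
def Cmd.writesN : Cmd → List ℕ
  | .setN a _ _ _ _ => [a]
  | .setR _ _ _ _ _ => []
  | .seq c₁ c₂ => c₁.writesN ++ c₂.writesN
  | .ite _ c₁ c₂ => c₁.writesN ++ c₂.writesN
  | .loop _ c => c.writesN

/-- The arrays of real numbers that a program may write. -/
def Cmd.writesR : Cmd → List ℕ
  | .setN _ _ _ _ _ => []
  | .setR a _ _ _ _ => [a]
  | .seq c₁ c₂ => c₁.writesR ++ c₂.writesR
  | .ite _ c₁ c₂ => c₁.writesR ++ c₂.writesR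
  | .loop _ c => c.writesR

lemma Exec.nat_eq {c : Cmd} {σ σ' : Mem} {t w : ℕ} (h : Exec c σ σ' t w) {a : ℕ}
    (ha : a ∉ c.writesN) : σ'.nat a = σ.nat a := by
  induction h with
  | setN σ b len idx val guard excl =>
    simp only [Cmd.writesN, List.mem_singleton] at ha
    exact Function.update_of_ne ha _ _
  | setR => rfl
  | seq h₁ h₂ ih₁ ih₂ =>
    simp only [Cmd.writesN, List.mem_append, not_or] at ha
    rw [ih₂ ha.2, ih₁ ha.1]
  | ite_true hb h ih =>
    simp only [Cmd.writesN, List.mem_append, not_or] at ha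
    exact ih ha.1
  | ite_false hb h ih =>
    simp only [Cmd.writesN, List.mem_append, not_or] at ha
    exact ih ha.2
  | loop_done => rfl
  | loop_step hb h₁ h₂ ih₁ ih₂ => rw [ih₂ ha, ih₁ ha]

lemma Exec.real_eq {c : Cmd} {σ σ' : Mem} {t w : ℕ} (h : Exec c σ σ' t w) {a : ℕ}
    (ha : a ∉ c.writesR) : σ'.real a = σ.real a := by
  induction h with
  | setR σ b len idx val guard excl =>
    simp only [Cmd.writesR, List.mem_singleton] at ha
    exact Function.update_of_ne ha _ _
  | setN => rfl
  | seq h₁ h₂ ih₁ ih₂ =>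
    simp only [Cmd.writesR, List.mem_append, not_or] at ha
    rw [ih₂ ha.2, ih₁ ha.1]
  | ite_true hb h ih =>
    simp only [Cmd.writesR, List.mem_append, not_or] at ha
    exact ih ha.1
  | ite_false hb h ih =>
    simp only [Cmd.writesR, List.mem_append, not_or] at ha
    exact ih ha.2
  | loop_done => rfl
  | loop_step hb h₁ h₂ ih₁ ih₂ => rw [ih₂ ha, ih₁ ha]

/-- The program halts, every operation of its text being executed at most `X` times, by at most
`m` processors. -/
def Runs (m X : ℕ) (c : Cmd) (σ σ' : Mem) : Prop :=
  ∃ t w, Exec c σ σ' t w ∧ t ≤ X * c.ops ∧ w ≤ X * c.ops * m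

namespace Runs

variable {m X Y : ℕ} {c c₁ c₂ : Cmd} {σ σ₁ σ₂ σ' : Mem}

lemma nat_eq (h : Runs m X c σ σ') {a : ℕ} (ha : a ∉ c.writesN) : σ'.nat a = σ.nat a := by
  obtain ⟨_, _, h, _⟩ := h
  exact h.nat_eq ha

lemma real_eq (h : Runs m X c σ σ') {a : ℕ} (ha : a ∉ c.writesR) : σ'.real a = σ.real a := by
  obtain ⟨_, _, h, _⟩ := h
  exact h.real_eq ha

lemma mono (h : Runs m X c σ σ') (hXY : X ≤ Y) : Runs m Y c σ σ' := by
  obtain ⟨t, w, h, ht, hw⟩ := h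
  exact ⟨t, w, h, ht.trans (by gcongr), hw.trans (by gcongr)⟩

lemma seq (h₁ : Runs m X c₁ σ σ₁) (h₂ : Runs m X c₂ σ₁ σ₂) : Runs m X (.seq c₁ c₂) σ σ₂ := by
  obtain ⟨t₁, w₁, e₁, ht₁, hw₁⟩ := h₁
  obtain ⟨t₂, w₂, e₂, ht₂, hw₂⟩ := h₂
  refine ⟨_, _, e₁.seq e₂, ?_, ?_⟩
  · rw [Cmd.ops, mul_add]; omega
  · rw [Cmd.ops, mul_add, add_mul]; omega

end Runs

/-- The trivial test. -/
def BExp.tt : BExp := .nlt (.const 0) (.const 1)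

@[simp] lemma BExp.eval_tt (σ : Mem) (i : ℕ) : BExp.tt.eval σ i := by
  simp [BExp.tt, BExp.eval, NExp.eval]

/-- Each processor writes its own cell of an array of natural numbers. -/
def parN (a : ℕ) (len val : NExp) (guard : BExp) : Cmd := .setN a len .pid val guard

/-- Each processor writes its own cell of an array of real numbers. -/
def parR (a : ℕ) (len : NExp) (val : RExp) (guard : BExp) : Cmd := .setR a len .pid val guard

lemma scatter_id {α : Type} (A : ℕ → α) (P : ℕ → Prop) [DecidablePred P] (val : ℕ → α) :
    scatter A {i | P i} (fun i => i) val = fun j => if P j then val j else A j := by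
  funext j
  unfold scatter
  by_cases h : P j
  · have h' : ∃ i ∈ {i | P i}, i = j := ⟨j, h, rfl⟩
    rw [dif_pos h', if_pos h, h'.choose_spec.2]
  · rw [dif_neg (by rintro ⟨i, hi, rfl⟩; exact h hi), if_neg h]

open Classical in
lemma runs_parN {m : ℕ} (hm : 1 ≤ m) (σ : Mem) (a : ℕ) (len val : NExp) (guard : BExp)
    (hl : len.eval σ 0 ≤ m) : ∃ f, Runs m 1 (parN a len val guard) σ (σ.setN a f) ∧
      (∀ j < len.eval σ 0, guard.eval σ j → f j = val.eval σ j) ∧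
      (∀ j, ¬ (j < len.eval σ 0 ∧ guard.eval σ j) → f j = σ.nat a j) := by
  have e := Exec.setN σ a len .pid val guard (fun i _ j _ h => h)
  simp only [NExp.eval, writers] at e
  rw [scatter_id] at e
  refine ⟨_, ⟨_, _, e, ?_, ?_⟩, fun j h h' => if_pos ⟨h, h'⟩, fun j h => if_neg h⟩
  · simp [parN, Cmd.ops]
  · simp only [parN, Cmd.ops, one_mul, add_mul (NExp.ops len)]
    rw [mul_comm (len.eval σ 0)]
    gcongr
    exact Nat.le_mul_of_pos_right _ hm

open Classical in
lemma runs_parR {m : ℕ} (hm : 1 ≤ m) (σ : Mem) (a : ℕ) (len : NExp) (val : RExp) (guard : BExp)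
    (hl : len.eval σ 0 ≤ m) : ∃ f, Runs m 1 (parR a len val guard) σ (σ.setR a f) ∧
      (∀ j < len.eval σ 0, guard.eval σ j → f j = val.eval σ j) ∧
      (∀ j, ¬ (j < len.eval σ 0 ∧ guard.eval σ j) → f j = σ.real a j) := by
  have e := Exec.setR σ a len .pid val guard (fun i _ j _ h => h)
  simp only [NExp.eval, writers] at e
  rw [scatter_id] at e
  refine ⟨_, ⟨_, _, e, ?_, ?_⟩, fun j h h' => if_pos ⟨h, h'⟩, fun j h => if_neg h⟩
  · simp [parR, Cmd.ops]
  · simp only [parR, Cmd.ops, one_mul, add_mul (NExp.ops len)]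
    rw [mul_comm (len.eval σ 0)]
    gcongr
    exact Nat.le_mul_of_pos_right _ hm

/-- `I k` is the invariant after `k` rounds. The factor is `K + 1` because the test is evaluated
once more when it fails. -/
lemma runs_loop {m X : ℕ} (hm : 1 ≤ m) (hX : 1 ≤ X) {b : BExp} {c : Cmd} (I : ℕ → Mem → Prop) (K : ℕ)
    (hstep : ∀ k < K, ∀ σ, I k σ → b.eval σ 0 ∧ ∃ σ', Runs m X c σ σ' ∧ I (k + 1) σ')
    (hend : ∀ σ, I K σ → ¬ b.eval σ 0) {σ : Mem} (h0 : I 0 σ) :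
    ∃ σ', Runs m ((K + 1) * X) (.loop b c) σ σ' ∧ I K σ' := by
  induction K generalizing I σ with
  | zero =>
    refine ⟨σ, ⟨_, _, .loop_done (hend σ h0), ?_, ?_⟩, h0⟩
    · simp only [Cmd.ops]; nlinarith
    · simp only [Cmd.ops]
      calc b.ops = 1 * (b.ops + 0) * 1 := by ring
        _ ≤ _ := by gcongr <;> omega
  | succ K ih =>
    obtain ⟨hb, σ₁, ⟨t₁, w₁, e₁, ht₁, hw₁⟩, h1⟩ := hstep 0 K.succ_pos σ h0
    obtain ⟨σ₂, ⟨t₂, w₂, e₂, ht₂, hw₂⟩, h2⟩ := ih (fun k => I (k + 1))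
      (fun k hk σ h => hstep (k + 1) (by omega) σ h) hend h1
    refine ⟨σ₂, ⟨_, _, .loop_step hb e₁ e₂, ?_, ?_⟩, h2⟩
    · simp only [Cmd.ops] at *
      have : b.ops ≤ X * b.ops := Nat.le_mul_of_pos_left _ hX
      have e : (K + 1 + 1) * X * (b.ops + c.ops) = X * b.ops + X * c.ops
        + (K + 1) * X * (b.ops + c.ops) := by ring
      omega
    · simp only [Cmd.ops] at *
      have : b.ops ≤ X * b.ops * m :=
        (Nat.le_mul_of_pos_left _ hX).trans (Nat.le_mul_of_pos_right _ hm)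
      have e : (K + 1 + 1) * X * (b.ops + c.ops) * m = X * b.ops * m + X * c.ops * m
        + (K + 1) * X * (b.ops + c.ops) * m := by ring
      omega

/-- Repeat a program, counting in cell `0` of an array of natural numbers, while the counter is
below a real number. -/
def forLoop (ctr : ℕ) (bound : RExp) (body : Cmd) : Cmd :=
  .seq (parN ctr (.const 1) (.const 0) .tt)
    (.loop (.rlt (.ofNat (.read ctr (.const 0))) bound)
      (.seq body (parN ctr (.const 1) (.add (.read ctr (.const 0)) (.const 1)) .tt)))

/-- A natural number `k` satisfies `k < β` exactly when `k < ⌈β⌉₊`, so comparing the counter with a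
real bound performs the rounding up. -/
lemma runs_forLoop {m X : ℕ} (hm : 1 ≤ m) (hX : 1 ≤ X) {ctr : ℕ} {bound : RExp} {body : Cmd}
    (I : ℕ → Mem → Prop) (β : ℝ) (hbound : ∀ k σ, I k σ → bound.eval σ 0 = β)
    (hbody : ∀ k σ, I k σ → ∃ σ', Runs m X body σ σ' ∧ I (k + 1) σ')
    (hctr : ctr ∉ body.writesN) (hI : ∀ k σ f, I k σ → I k (σ.setN ctr f))
    {σ : Mem} (h0 : I 0 σ) :
    ∃ σ', Runs m ((⌈β⌉₊ + 1) * X) (forLoop ctr bound body) σ σ' ∧ I ⌈β⌉₊ σ' ∧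
      σ'.nat ctr 0 = ⌈β⌉₊ := by
  obtain ⟨f, r0, hf, -⟩ := runs_parN hm σ ctr (.const 1) (.const 0) .tt hm
  suffices ∃ σ', Runs m ((⌈β⌉₊ + 1) * X) (.loop (.rlt (.ofNat (.read ctr (.const 0))) bound)
      (.seq body (parN ctr (.const 1) (.add (.read ctr (.const 0)) (.const 1)) .tt)))
      (σ.setN ctr f) σ' ∧ (I ⌈β⌉₊ σ' ∧ σ'.nat ctr 0 = ⌈β⌉₊) by
    obtain ⟨σ', r, h⟩ := this
    exact ⟨σ', (r0.mono (by nlinarith)).seq r, h⟩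
  refine runs_loop hm hX (fun k σ => I k σ ∧ σ.nat ctr 0 = k) ⌈β⌉₊ ?_ ?_
    ⟨hI 0 σ _ h0, by simp [hf 0 one_pos, NExp.eval]⟩
  · rintro k hk σ ⟨h, hc⟩
    refine ⟨?_, ?_⟩
    · simp only [BExp.eval, RExp.eval, NExp.eval, hc, hbound k σ h]
      exact Nat.lt_ceil.1 hk
    · obtain ⟨σ₁, r₁, h₁⟩ := hbody k σ h
      obtain ⟨f, r₂, hf, -⟩ :=
        runs_parN hm σ₁ ctr (.const 1) (.add (.read ctr (.const 0)) (.const 1)) .tt hm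
      refine ⟨_, r₁.seq (r₂.mono hX), hI _ _ _ h₁, ?_⟩
      simp [hf 0 one_pos, NExp.eval, r₁.nat_eq hctr, hc]
  · rintro σ ⟨h, hc⟩
    simp only [BExp.eval, RExp.eval, NExp.eval, hc, hbound _ σ h, not_lt]
    exact Nat.le_ceil β


/-! ### Expressions and subroutines -/

/-- The number of vertices. -/
def eVerts : NExp := .read 2 (.const 0)

/-- The number of darts. -/
def eDarts : NExp := .read 0 eVerts

/-- The tail of the own dart. -/
def eTail : NExp := .read 3 .pid

/-- The first dart at the tail. -/
def eFst : NExp := .read 0 eTail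

/-- The end of the segment of darts at the tail. -/
def eEnd : NExp := .read 0 (.add eTail (.const 1))

/-- The first dart at the head. -/
def eHead : NExp := .read 0 (.read 1 .pid)

/-- The degree of the tail. -/
def eDeg : RExp := .ofNat (.sub eEnd eFst)

/-- The own cell of a real array. -/
def cell (a : ℕ) : RExp := .read a .pid

/-- The cell of a real array that belongs to the head. -/
def headCell (a : ℕ) : RExp := .read a eHead

/-- Cell `0` of a real array. -/
def scalar (a : ℕ) : RExp := .read a (.const 0)

/-- A numeral. -/
def num (c : ℕ) : RExp := .ofNat (.const c)

/-- The sum over the segment at the tail, from prefix sums. -/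
def segSum : RExp := .sub (.read 2 eEnd) (.read 2 eFst)

/-- The total sum, from prefix sums. -/
def total : RExp := .read 2 eDarts

/-- The current power of two. -/
def ePow : NExp := .read 4 (.const 0)

/-- Double the current power of two. -/
def dblPow : Cmd := parN 4 (.const 1) (.add ePow ePow) .tt

/-- Binary search for the tails of all darts. -/
def findTails : Cmd :=
  .seq (parN 4 (.const 1) (.const 1) .tt) (.seq (.loop (.nlt ePow eVerts) dblPow)
    (.loop (.nlt (.const 1) ePow)
      (.seq (parN 4 (.const 1) (.half ePow) .tt)
        (parN 3 eDarts (.add eTail ePow)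
          (.and (.nlt (.add eTail ePow) eVerts)
            (.not (.nlt .pid (.read 0 (.add eTail ePow)))))))))

/-- Prefix sums of real array `2`, by doubling. -/
def scan : Cmd :=
  .seq (parN 4 (.const 1) (.const 1) .tt)
    (.loop (.nlt ePow (.add eDarts (.const 1)))
      (.seq (parR 2 (.add eDarts (.const 1)) (.add (cell 2) (.read 2 (.sub .pid ePow)))
        (.not (.nlt .pid ePow))) dblPow))

/-- Prefix sums of an expression over all darts, into real array `2`. -/
def sumOf (e : RExp) : Cmd :=
  .seq (parR 11 eDarts e .tt)
    (.seq (parR 2 (.add eDarts (.const 1))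
      -- Shift by one position. Differences are truncated, so the second factor is 0 in cell `0` and
      -- 1 elsewhere; the scan then gives sums over the indices strictly below each position.
      (.mul (.read 11 (.sub .pid (.const 1))) (.ofNat (.sub .pid (.sub .pid (.const 1))))) .tt)
      scan)

/-- The best response in the box, into real array `3`. -/
def xStep : Cmd :=
  .seq (parR 3 eDarts
    (.div (.sub (num 0) (cell 7)) (.mul (num 2) (.add (cell 4) (headCell 4)))) .tt)
    (.seq (parR 3 eDarts (num 1) (.rlt (num 1) (cell 3)))
      (parR 3 eDarts (.sub (num 0) (num 1)) (.rlt (cell 3) (.sub (num 0) (num 1)))))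

/-- The best response in the simplex, into real array `4`. -/
def yStep : Cmd :=
  .seq (sumOf (.mul (cell 3) (cell 3)))
    (.seq (parR 4 eDarts (.exp (.div (.sub (num 0) (.add (cell 8) (.mul (num 2) segSum)))
      (.mul (num 1000) (scalar 10)))) .tt)
      -- A vertex value is repeated at each outgoing dart; dividing by the degree makes the sum over
      -- darts a sum over vertices.
      (.seq (sumOf (.div (cell 4) eDeg)) (parR 4 eDarts (.div (cell 4) total) .tt)))

/-- The number of rounds of alternating minimization, as a real number. -/
def altBound : RExp :=
  .mul (num 2) (.log (.div (.mul (.mul (num 8000) (scalar 10)) (.ofNat eVerts)) (scalar 0)))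

/-- Alternating minimization. -/
def altMin : Cmd :=
  .seq (parR 4 eDarts (num 1) .tt) (.seq xStep (forLoop 6 altBound (.seq yStep xStep)))

/-- A multiple of the gradient in the box variable, added to a cell. -/
def addGradX (a c : ℕ) : RExp := .add (cell a) (.mul (num c) (.sub (cell 4) (headCell 4)))

/-- A multiple of the gradient in the simplex variable, added to a cell. -/
def addGradY (a c : ℕ) : RExp :=
  .add (cell a) (.mul (num c) (.sub (num 0) (.add (.mul (num 2) eDeg) (.mul (num 2) segSum))))

/-- A step of dual extrapolation. -/
def mainStep : Cmd :=
  -- Real arrays `5`, `6`, `9` hold the state, `7` and `8` the functional to be minimized, `3` and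
  -- `4` the resulting box and simplex vectors.
  .seq (parR 7 eDarts (cell 5) .tt) (.seq (parR 8 eDarts (cell 6) .tt) (.seq altMin
    (.seq (sumOf (cell 3)) (.seq (parR 7 eDarts (addGradX 5 2) .tt)
      (.seq (parR 8 eDarts (addGradY 6 2) .tt) (.seq altMin
        (.seq (sumOf (cell 3)) (.seq (parR 5 eDarts (addGradX 5 1) .tt)
          (.seq (parR 6 eDarts (addGradY 6 1) .tt)
            (parR 9 eDarts (.add (cell 9) (cell 4)) .tt))))))))))

/-- The number of steps of dual extrapolation, as a real number. -/
def mainBound : RExp :=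
  .div (.mul (.mul (num 3000) (scalar 10)) (.log (.ofNat eVerts))) (scalar 0)

/-- A bound on the maximum degree, into real array `10`. -/
def degBound : Cmd :=
  .seq (sumOf (.exp (.mul (.log (.ofNat eVerts)) (.log eDeg))))
    (parR 10 (.const 1) (.exp (.div (.log total) (.log (.ofNat eVerts)))) .tt)

/-- The value of the average simplex iterate, into real array `1`. -/
def finish : Cmd :=
  .seq (parR 3 eDarts (cell 9) .tt) (.seq (parR 3 eDarts (headCell 9) (.rlt (headCell 9) (cell 9)))
    (.seq (sumOf (cell 3))
      (parR 1 (.const 1) (.div total (.mul (num 2) (.ofNat (.read 5 (.const 0))))) .tt)))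

/-- The densest-subgraph program. -/
def densest : Cmd :=
  .seq findTails (.seq degBound (.seq (forLoop 5 mainBound mainStep) finish))

/-! ### Binary search and prefix sums -/

lemma runs_writeOne {m : ℕ} (hm : 1 ≤ m) (σ : Mem) (val : NExp) :
    ∃ f, Runs m 1 (parN 4 (.const 1) val .tt) σ (σ.setN 4 f) ∧ f 0 = val.eval σ 0 := by
  obtain ⟨f, r, h, -⟩ := runs_parN hm σ 4 (.const 1) val .tt hm
  exact ⟨f, r, h 0 one_pos (BExp.eval_tt _ _)⟩

lemma lt_clog_iff {k N : ℕ} : k < Nat.clog 2 N ↔ 2 ^ k < N := by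
  rw [← not_le, ← not_le, Nat.clog_le_iff_le_pow one_lt_two]

/-- Prefix sums in logarithmic parallel time. -/
lemma runs_scan {N B : ℕ} {σ : Mem} (hN : eDarts.eval σ 0 = N) (hB : Nat.clog 2 (N + 1) ≤ B) :
    ∃ σ', Runs (N + 1) (B + 1) scan σ σ' ∧
      ∀ j ≤ N, σ'.real 2 j = ∑ i ∈ Finset.range (j + 1), σ.real 2 i := by
  have hm : 1 ≤ N + 1 := by omega
  obtain ⟨f, r0, hf⟩ := runs_writeOne hm σ (.const 1)
  suffices ∃ σ', Runs (N + 1) ((Nat.clog 2 (N + 1) + 1) * 1) (.loop (.nlt ePow (.add eDarts (.const 1)))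
      (.seq (parR 2 (.add eDarts (.const 1)) (.add (cell 2) (.read 2 (.sub .pid ePow)))
        (.not (.nlt .pid ePow))) dblPow)) (σ.setN 4 f) σ' ∧
        (eDarts.eval σ' 0 = N ∧ σ'.nat 4 0 = 2 ^ Nat.clog 2 (N + 1) ∧ ∀ j ≤ N, σ'.real 2 j =
          ∑ i ∈ Finset.Ico (j + 1 - 2 ^ Nat.clog 2 (N + 1)) (j + 1), σ.real 2 i) by
    obtain ⟨σ', r, -, -, h⟩ := this
    refine ⟨σ', (r0.mono (by omega)).seq (r.mono (by omega)), fun j hj => ?_⟩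
    have := Nat.le_pow_clog one_lt_two (N + 1)
    rw [h j hj, Nat.sub_eq_zero_of_le (by omega), Finset.range_eq_Ico]
  -- After `k` rounds each cell holds the sum of the window of length `2 ^ k` ending there;
  -- truncated subtraction cuts the window off at position 0.
  refine runs_loop hm le_rfl (fun k τ => eDarts.eval τ 0 = N ∧ τ.nat 4 0 = 2 ^ k ∧ ∀ j ≤ N,
    τ.real 2 j = ∑ i ∈ Finset.Ico (j + 1 - 2 ^ k) (j + 1), σ.real 2 i) _ ?_ ?_ ⟨?_, ?_, ?_⟩
  · rintro k hk τ ⟨h1, h2, h3⟩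
    rw [lt_clog_iff] at hk
    refine ⟨by simpa [BExp.eval, NExp.eval, ePow, h1, h2] using hk, ?_⟩
    obtain ⟨g, r1, hg, hg'⟩ := runs_parR hm τ 2 (.add eDarts (.const 1))
      (.add (cell 2) (.read 2 (.sub .pid ePow))) (.not (.nlt .pid ePow))
      (by simp [NExp.eval, h1])
    obtain ⟨f, r2, hf⟩ := runs_writeOne hm (τ.setR 2 g) (.add ePow ePow)
    refine ⟨_, r1.seq r2, ?_, ?_, ?_⟩
    · simpa [eDarts, eVerts, NExp.eval] using h1
    · simp [hf, NExp.eval, ePow, h2, pow_succ, mul_two]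
    · intro j hj
      simp only [Mem.setN_real, Mem.setR_real, if_true]
      simp only [NExp.eval, h1, BExp.eval, RExp.eval, ePow, cell, h2, not_lt] at hg hg'
      by_cases h : 2 ^ k ≤ j
      · rw [hg j (by omega) h, h3 j hj, h3 (j - 2 ^ k) (by omega), add_comm,
          show j + 1 - 2 ^ k = j - 2 ^ k + 1 by omega, Finset.sum_Ico_consecutive _ (by omega) (by omega),
          pow_succ, show j - 2 ^ k + 1 - 2 ^ k = j + 1 - 2 ^ k * 2 by omega]
      · rw [hg' j (by omega), h3 j hj, pow_succ,
          show j + 1 - 2 ^ k = 0 by omega, show j + 1 - 2 ^ k * 2 = 0 by omega]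
  · rintro τ ⟨h1, h2, -⟩
    have := Nat.le_pow_clog one_lt_two (N + 1)
    simpa [BExp.eval, NExp.eval, ePow, h1, h2] using this
  · simpa [eDarts, eVerts, NExp.eval] using hN
  · simp [hf, NExp.eval]
  · intro j _
    simp

/-- Prefix sums of an expression. -/
lemma runs_sumOf {N B : ℕ} {σ : Mem} (hN : eDarts.eval σ 0 = N) (hB : Nat.clog 2 (N + 1) ≤ B)
    (e : RExp) : ∃ σ', Runs (N + 1) (B + 1) (sumOf e) σ σ' ∧
      ∀ j ≤ N, σ'.real 2 j = ∑ i ∈ Finset.range j, e.eval σ i := by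
  have hm : 1 ≤ N + 1 := by omega
  obtain ⟨f, r1, hf, -⟩ := runs_parR hm σ 11 eDarts e .tt (by omega)
  have hN1 : eDarts.eval (σ.setR 11 f) 0 = N := by simpa [eDarts, eVerts, NExp.eval] using hN
  obtain ⟨g, r2, hg, -⟩ := runs_parR hm (σ.setR 11 f) 2 (.add eDarts (.const 1))
    (.mul (.read 11 (.sub .pid (.const 1))) (.ofNat (.sub .pid (.sub .pid (.const 1))))) .tt
    (by simp [NExp.eval, hN1])
  have hN2 : eDarts.eval ((σ.setR 11 f).setR 2 g) 0 = N := by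
    simpa [eDarts, eVerts, NExp.eval] using hN
  obtain ⟨σ', r3, h⟩ := runs_scan hN2 hB
  refine ⟨σ', (r1.mono (by omega)).seq ((r2.mono (by omega)).seq r3), fun j hj => ?_⟩
  rw [h j hj, Finset.sum_range_succ']
  simp only [Mem.setR_real, if_true]
  have hv : ∀ i ≤ N, g i = f (i - 1) * ((i - (i - 1) : ℕ) : ℝ) := by
    intro i hi
    rw [hg i (by simp [NExp.eval, hN1]; omega) (BExp.eval_tt _ _)]
    simp [RExp.eval, NExp.eval]
  rw [hv 0 (by omega)]
  simp only [Nat.zero_sub, Nat.sub_zero, Nat.cast_zero, mul_zero, add_zero]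
  refine Finset.sum_congr rfl fun i hi => ?_
  rw [Finset.mem_range] at hi
  rw [hv _ (by omega), hf _ (by omega) (BExp.eval_tt _ _)]
  simp

section

variable {n : ℕ} {G : SimpleGraph (Fin n)} [DecidableRel G.Adj] {off adj : ℕ → ℕ}

lemma runs_findTails (hA : IsAdjacencyArray G off adj) {B : ℕ} (hB : Nat.clog 2 n ≤ B) {σ : Mem}
    (h0 : σ.nat 0 = off) (h2 : σ.nat 2 0 = n) (h3 : ∀ j, σ.nat 3 j = 0) :
    ∃ σ', Runs (off n + 1) (B + 1) findTails σ σ' ∧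
      ∀ j : Fin (off n), σ'.nat 3 j = (hA.dartGraph.tail j).1 := by
  have hm : 1 ≤ off n + 1 := by omega
  obtain ⟨f, r0, hf⟩ := runs_writeOne hm σ (.const 1)
  have hloop1 : ∃ σ', Runs (off n + 1) ((Nat.clog 2 n + 1) * 1) (.loop (.nlt ePow eVerts) dblPow)
      (σ.setN 4 f) σ' ∧ (σ'.nat 2 0 = n ∧ σ'.nat 4 0 = 2 ^ Nat.clog 2 n) := by
    refine runs_loop hm le_rfl (fun k τ => τ.nat 2 0 = n ∧ τ.nat 4 0 = 2 ^ k) _ ?_ ?_ ⟨?_, ?_⟩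
    · rintro k hk τ ⟨a, b⟩
      have hn : 1 ≤ n := by
        by_contra h
        rw [show n = 0 by omega, Nat.clog_zero_right] at hk
        omega
      rw [lt_clog_iff] at hk
      refine ⟨by simpa [BExp.eval, NExp.eval, ePow, eVerts, a, b] using hk, ?_⟩
      obtain ⟨f, r2, hf⟩ := runs_writeOne hm τ (.add ePow ePow)
      exact ⟨_, r2, by simpa using a, by simp [hf, NExp.eval, ePow, b, pow_succ, mul_two]⟩
    · rintro τ ⟨a, b⟩
      have := Nat.le_pow_clog one_lt_two n
      simpa [BExp.eval, NExp.eval, ePow, eVerts, a, b] using this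
    · simpa using h2
    · simp [hf, NExp.eval]
  obtain ⟨σ₁, r1, ha, hb⟩ := hloop1
  have e0 : σ₁.nat 0 = off := by rw [r1.nat_eq (by decide), r0.nat_eq (by decide), h0]
  have e3 : ∀ j, σ₁.nat 3 j = 0 := by
    intro j; rw [r1.nat_eq (by decide), r0.nat_eq (by decide), h3]
  set K := Nat.clog 2 n with hK
  suffices ∃ σ', Runs (off n + 1) ((K + 1) * 1) (.loop (.nlt (.const 1) ePow)
      (.seq (parN 4 (.const 1) (.half ePow) .tt)
        (parN 3 eDarts (.add eTail ePow)
          (.and (.nlt (.add eTail ePow) eVerts)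
            (.not (.nlt .pid (.read 0 (.add eTail ePow)))))))) σ₁ σ' ∧
      (σ'.nat 0 = off ∧ σ'.nat 2 0 = n ∧ K ≤ K ∧ σ'.nat 4 0 = 2 ^ (K - K) ∧
        ∀ j < off n, σ'.nat 3 j < n ∧ off (σ'.nat 3 j) ≤ j ∧
          ¬ (σ'.nat 3 j + 2 ^ (K - K) < n ∧ off (σ'.nat 3 j + 2 ^ (K - K)) ≤ j)) by
    obtain ⟨σ', r2, -, -, -, -, h⟩ := this
    refine ⟨σ', (r0.mono (by omega)).seq ((r1.mono (by omega)).seq (r2.mono (by omega))), fun j => ?_⟩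
    obtain ⟨a, b, c⟩ := h j j.2
    have hj := j.2
    simp only [Nat.sub_self, pow_zero, not_and, not_le] at c
    refine hA.tail_unique a (Fin.is_lt _) b ?_ (hA.off_fst_le j) (hA.lt_off_fst j)
    rcases lt_or_ge (σ'.nat 3 j + 1) n with h' | h'
    · exact c h'
    · rw [show σ'.nat 3 j + 1 = n by omega]; exact j.2
  -- Search for the largest `v < n` with `off v ≤ j`: the candidate is always admissible, the
  -- candidate plus the current power of two never is. Taking the largest skips isolated vertices,
  -- whose offset equals the next one.
  refine runs_loop hm le_rfl (fun k τ => τ.nat 0 = off ∧ τ.nat 2 0 = n ∧ k ≤ K ∧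
    τ.nat 4 0 = 2 ^ (K - k) ∧ ∀ j < off n, τ.nat 3 j < n ∧ off (τ.nat 3 j) ≤ j ∧
      ¬ (τ.nat 3 j + 2 ^ (K - k) < n ∧ off (τ.nat 3 j + 2 ^ (K - k)) ≤ j)) K ?_ ?_
    ⟨e0, ha, by omega, hb, ?_⟩
  · rintro k hk τ ⟨a0, a2, -, a4, a3⟩
    obtain ⟨q, hq⟩ : ∃ q, q = 2 ^ (K - (k + 1)) := ⟨_, rfl⟩
    have hq2 : 2 ^ (K - k) = 2 * q := by
      rw [hq, show K - k = K - (k + 1) + 1 by omega, pow_succ, mul_comm]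
    have hq0 : 0 < q := by rw [hq]; positivity
    rw [hq2] at a4 a3
    refine ⟨by simp [BExp.eval, NExp.eval, ePow, a4]; omega, ?_⟩
    obtain ⟨f, r2, hf⟩ := runs_writeOne hm τ (.half ePow)
    have hf' : f 0 = q := by rw [hf]; simp [NExp.eval, ePow, a4]
    obtain ⟨g, r3, hg, hg'⟩ := runs_parN hm (τ.setN 4 f) 3 eDarts (.add eTail ePow)
          (.and (.nlt (.add eTail ePow) eVerts)
            (.not (.nlt .pid (.read 0 (.add eTail ePow)))))
      (by simp [eDarts, eVerts, NExp.eval, a0, a2])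
    refine ⟨_, r2.seq r3, by simp [a0], by simp [a2], hk, by simp [hf', hq], ?_⟩
    intro j hj
    rw [← hq]
    simp only [Mem.setN_nat, if_true]
    simp [eDarts, eVerts, NExp.eval, a0, a2, BExp.eval, eTail, ePow, hf'] at hg hg'
    obtain ⟨b1, b2, b3⟩ := a3 j hj
    by_cases h : τ.nat 3 j + q < n ∧ off (τ.nat 3 j + q) ≤ j
    · rw [hg j hj h.1 h.2]
      refine ⟨h.1, h.2, ?_⟩
      rwa [add_assoc, ← two_mul]
    · rw [hg' j (fun _ h1 => by by_contra h2; exact h ⟨h1, by omega⟩)]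
      exact ⟨b1, b2, h⟩
  · rintro τ ⟨-, -, -, a4, -⟩
    simp [BExp.eval, NExp.eval, ePow, a4]
  · intro j hj
    rw [e3]
    obtain ⟨v, -⟩ := hA.exists_tail hj
    refine ⟨v.pos, by rw [hA.off_zero]; omega, ?_⟩
    have := Nat.le_pow_clog one_lt_two n
    rw [← hK] at this
    rw [Nat.sub_zero, zero_add]
    omega

end


section

variable {n : ℕ} {G : SimpleGraph (Fin n)} [DecidableRel G.Adj] {off adj : ℕ → ℕ}

/-! ### The steps of the optimization -/

/-- The memory holds the adjacency array, the tails of the darts, the precision `ε`, and the degree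
bound `dl`. -/
structure Ctx (hA : IsAdjacencyArray G off adj) (ε dl : ℝ) (σ : Mem) : Prop where
  off_eq : σ.nat 0 = off
  adj_eq : σ.nat 1 = adj
  verts : σ.nat 2 0 = n
  tail : ∀ j : Fin (off n), σ.nat 3 j = (hA.dartGraph.tail j).1
  eps : σ.real 0 0 = ε
  degBound : σ.real 10 0 = dl

/-- A program does not change the context. -/
def Cmd.Safe (c : Cmd) : Prop :=
  (∀ a ∈ [0, 1, 2, 3], a ∉ c.writesN) ∧ ∀ a ∈ [0, 10], a ∉ c.writesR

instance (c : Cmd) : Decidable c.Safe := by unfold Cmd.Safe; infer_instance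

variable {hA : IsAdjacencyArray G off adj} {ε dl : ℝ} {σ σ' : Mem}

/-- A real array represents a function on the darts. -/
def RepD (f : ℕ → ℝ) (x : Fin (off n) → ℝ) : Prop := ∀ j : Fin (off n), f j = x j

/-- A real array represents a function on the vertices that are not isolated. -/
def RepW (hA : IsAdjacencyArray G off adj) (f : ℕ → ℝ) (y : {v : Fin n // 0 < G.degree v} → ℝ) :
    Prop := ∀ j : Fin (off n), f j = y (hA.dartGraph.tail j)

namespace Ctx

lemma congr (h : Ctx hA ε dl σ) (hN : ∀ a ∈ [0, 1, 2, 3], σ'.nat a = σ.nat a)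
    (hR : ∀ a ∈ [0, 10], σ'.real a = σ.real a) : Ctx hA ε dl σ' where
  off_eq := by rw [hN 0 (by simp), h.off_eq]
  adj_eq := by rw [hN 1 (by simp), h.adj_eq]
  verts := by rw [hN 2 (by simp), h.verts]
  tail j := by rw [hN 3 (by simp), h.tail]
  eps := by rw [hR 0 (by simp), h.eps]
  degBound := by rw [hR 10 (by simp), h.degBound]

lemma of_runs {m X : ℕ} {c : Cmd} (h : Ctx hA ε dl σ) (r : Runs m X c σ σ') (hc : c.Safe) :
    Ctx hA ε dl σ' :=
  h.congr (fun a ha => r.nat_eq (hc.1 a ha)) (fun a ha => r.real_eq (hc.2 a ha))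

lemma setN (h : Ctx hA ε dl σ) {a : ℕ} (f : ℕ → ℕ) (ha : a ∉ [0, 1, 2, 3]) :
    Ctx hA ε dl (σ.setN a f) :=
  h.congr (fun b hb => by rw [Mem.setN_nat, if_neg (by rintro rfl; exact ha hb)]) (fun _ _ => rfl)

lemma eval_eVerts (h : Ctx hA ε dl σ) (i : ℕ) : eVerts.eval σ i = n := by
  simp [eVerts, NExp.eval, h.verts]

lemma eval_eDarts (h : Ctx hA ε dl σ) (i : ℕ) : eDarts.eval σ i = off n := by
  simp [eDarts, NExp.eval, h.eval_eVerts, h.off_eq]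

lemma eval_eFst (h : Ctx hA ε dl σ) (j : Fin (off n)) :
    eFst.eval σ j = off (hA.dartGraph.tail j).1 := by
  simp [eFst, eTail, NExp.eval, h.off_eq, h.tail]

lemma eval_eEnd (h : Ctx hA ε dl σ) (j : Fin (off n)) :
    eEnd.eval σ j = off ((hA.dartGraph.tail j).1 + 1) := by
  simp [eEnd, eTail, NExp.eval, h.off_eq, h.tail]

lemma eval_eDeg (h : Ctx hA ε dl σ) (j : Fin (off n)) :
    eDeg.eval σ j = hA.dartGraph.deg (hA.dartGraph.tail j) := by
  rw [hA.deg_eq]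
  simp [eDeg, RExp.eval, NExp.eval, h.eval_eFst, h.eval_eEnd, hA.off_succ]

/-- The head is not isolated, so its value is also stored at its own first dart, which the offsets
locate without the reverse dart. -/
lemma eval_headCell (h : Ctx hA ε dl σ) {a : ℕ} {y : {v : Fin n // 0 < G.degree v} → ℝ}
    (hy : RepW hA (σ.real a) y) (j : Fin (off n)) :
    (headCell a).eval σ j = y (hA.dartGraph.head j) := by
  have h1 := hy ⟨_, hA.off_lt (hA.dartGraph.head j)⟩
  rw [hA.tail_off] at h1
  rw [← h1]
  simp [headCell, eHead, RExp.eval, NExp.eval, h.off_eq, h.adj_eq, hA.head_val, hA.snd_eq]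

lemma runs_write (h : Ctx hA ε dl σ) (a : ℕ) (e : RExp) :
    ∃ σ', Runs (off n + 1) 1 (parR a eDarts e .tt) σ σ' ∧
      ∀ j : Fin (off n), σ'.real a j = e.eval σ j := by
  obtain ⟨f, r, hf, -⟩ := runs_parR (by omega) σ a eDarts e .tt
    (show eDarts.eval σ 0 ≤ off n + 1 by rw [h.eval_eDarts]; omega)
  exact ⟨_, r, fun j => by simp [hf j (by rw [h.eval_eDarts]; exact j.2) (BExp.eval_tt _ _)]⟩

open Classical in
lemma runs_guarded (h : Ctx hA ε dl σ) (a : ℕ) (e : RExp) (b : BExp) :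
    ∃ σ', Runs (off n + 1) 1 (parR a eDarts e b) σ σ' ∧
      ∀ j : Fin (off n), σ'.real a j = if b.eval σ j then e.eval σ j else σ.real a j := by
  obtain ⟨f, r, hf, hf'⟩ := runs_parR (by omega) σ a eDarts e b
    (show eDarts.eval σ 0 ≤ off n + 1 by rw [h.eval_eDarts]; omega)
  refine ⟨_, r, fun j => ?_⟩
  simp only [Mem.setR_real, if_true]
  split_ifs with hb
  · exact hf j (by rw [h.eval_eDarts]; exact j.2) hb
  · exact hf' j (by tauto)

lemma runs_sum (h : Ctx hA ε dl σ) {B : ℕ} (hB : Nat.clog 2 (off n + 1) ≤ B) {e : RExp}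
    {x : Fin (off n) → ℝ} (he : ∀ j : Fin (off n), e.eval σ j = x j) :
    ∃ σ', Runs (off n + 1) (B + 1) (sumOf e) σ σ' ∧ Ctx hA ε dl σ' ∧
      (∀ j : Fin (off n), segSum.eval σ' j = hA.dartGraph.outSum x (hA.dartGraph.tail j)) ∧
      ∀ i, total.eval σ' i = ∑ j, x j := by
  obtain ⟨σ', r, hs⟩ := runs_sumOf (h.eval_eDarts 0) hB e
  have h' : Ctx hA ε dl σ' := h.of_runs r (by constructor <;> simp [sumOf, scan, dblPow, parR, parN,
    Cmd.writesN, Cmd.writesR])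
  refine ⟨σ', r, h', fun j => ?_, fun i => ?_⟩
  · have hx : x = fun j : Fin (off n) => e.eval σ j := funext fun j => (he j).symm
    rw [hx, hA.outSum_eq (fun i => e.eval σ i)]
    simp only [segSum, RExp.eval, h'.eval_eFst, h'.eval_eEnd]
    rw [hs _ (hA.off_succ_le _), hs _ (hA.off_lt _).le]
  · simp only [total, RExp.eval, h'.eval_eDarts]
    rw [hs _ le_rfl, Finset.sum_range]
    exact Finset.sum_congr rfl fun j _ => he j

end Ctx

lemma eval_cell (σ : Mem) (a i : ℕ) : (cell a).eval σ i = σ.real a i := by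
  simp [cell, RExp.eval, NExp.eval]

lemma eval_num (σ : Mem) (c i : ℕ) : (num c).eval σ i = c := by simp [num, RExp.eval, NExp.eval]

lemma eval_scalar (σ : Mem) (a i : ℕ) : (scalar a).eval σ i = σ.real a 0 := by
  simp [scalar, RExp.eval, NExp.eval]

lemma runs_xStep (h : Ctx hA ε dl σ) {p : Fin (off n) → ℝ} {y : {v : Fin n // 0 < G.degree v} → ℝ}
    (hp : RepD (σ.real 7) p) (hy : RepW hA (σ.real 4) y) :
    ∃ σ', Runs (off n + 1) 1 xStep σ σ' ∧ RepD (σ'.real 3) (hA.dartGraph.xOpt p y) := by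
  obtain ⟨σ₁, r1, h1⟩ := h.runs_write 3
    (.div (.sub (num 0) (cell 7)) (.mul (num 2) (.add (cell 4) (headCell 4))))
  have c1 := h.of_runs r1 (by decide)
  obtain ⟨σ₂, r2, h2⟩ := c1.runs_guarded 3 (num 1) (.rlt (num 1) (cell 3))
  have c2 := c1.of_runs r2 (by decide)
  obtain ⟨σ₃, r3, h3⟩ := c2.runs_guarded 3 (.sub (num 0) (num 1))
    (.rlt (cell 3) (.sub (num 0) (num 1)))
  refine ⟨σ₃, r1.seq (r2.seq r3), fun j => ?_⟩
  rw [h3]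
  simp only [BExp.eval, RExp.eval, eval_cell, eval_num, h2, h1, h.eval_headCell hy, hp j, hy j]
  unfold DartGraph.xOpt
  push_cast
  simp only [zero_sub]
  generalize -p j / _ = a
  rw [max_def, min_def]
  split_ifs <;> linarith

lemma runs_yStep (h : Ctx hA ε dl σ) {B : ℕ} (hB : Nat.clog 2 (off n + 1) ≤ B)
    {q : {v : Fin n // 0 < G.degree v} → ℝ} {x : Fin (off n) → ℝ}
    (hq : RepW hA (σ.real 8) q) (hx : RepD (σ.real 3) x) :
    ∃ σ', Runs (off n + 1) (B + 1) yStep σ σ' ∧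
      RepW hA (σ'.real 4) (hA.dartGraph.yOpt (1000 * dl) q x) := by
  obtain ⟨σ₁, r1, c1, h1, -⟩ := h.runs_sum hB (e := .mul (cell 3) (cell 3)) (x := fun j => x j ^ 2)
    (fun j => by simp only [RExp.eval, eval_cell, hx j, sq])
  obtain ⟨σ₂, r2, h2⟩ := c1.runs_write 4
    (.exp (.div (.sub (num 0) (.add (cell 8) (.mul (num 2) segSum))) (.mul (num 1000) (scalar 10))))
  have c2 := c1.of_runs r2 (by decide)
  have h2' : RepW hA (σ₂.real 4) (hA.dartGraph.yRaw (1000 * dl) q x) := by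
    intro j
    rw [h2]
    simp only [RExp.eval, eval_cell, eval_num, eval_scalar, h1, c1.degBound,
      r1.real_eq (show 8 ∉ _ by decide), hq j, DartGraph.yRaw]
    norm_num
  obtain ⟨σ₃, r3, c3, -, h3⟩ := c2.runs_sum hB (e := .div (cell 4) eDeg)
    (x := fun j => hA.dartGraph.yRaw (1000 * dl) q x (hA.dartGraph.tail j) /
      hA.dartGraph.deg (hA.dartGraph.tail j))
    (fun j => by simp only [RExp.eval, eval_cell, h2' j, c2.eval_eDeg])
  obtain ⟨σ₄, r4, h4⟩ := c3.runs_write 4 (.div (cell 4) total)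
  refine ⟨σ₄, r1.seq ((r2.mono (by omega)).seq (r3.seq (r4.mono (by omega)))), fun j => ?_⟩
  rw [h4]
  simp only [RExp.eval, eval_cell, h3, r3.real_eq (show 4 ∉ _ by decide), h2' j, DartGraph.yOpt]
  congr 1
  rw [hA.dartGraph.sum_tail fun w => hA.dartGraph.yRaw (1000 * dl) q x w / hA.dartGraph.deg w]
  refine Finset.sum_congr rfl fun w _ => div_mul_cancel₀ _ ?_
  rw [hA.deg_eq]
  exact_mod_cast w.2.ne'

/-- The number of rounds of alternating minimization. -/
def altRounds (n : ℕ) (ε dl : ℝ) : ℕ := ⌈2 * Real.log (8000 * dl * n / ε)⌉₊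

/-- The number of steps of dual extrapolation. -/
def mainRounds (n : ℕ) (ε dl : ℝ) : ℕ := ⌈3000 * dl * Real.log n / ε⌉₊

lemma runs_altMin (h : Ctx hA ε dl σ) {B : ℕ} (hB : Nat.clog 2 (off n + 1) ≤ B)
    {p : Fin (off n) → ℝ} {q : {v : Fin n // 0 < G.degree v} → ℝ}
    (hp : RepD (σ.real 7) p) (hq : RepW hA (σ.real 8) q) :
    ∃ σ', Runs (off n + 1) ((altRounds n ε dl + 1) * (B + 1)) altMin σ σ' ∧
      RepD (σ'.real 3) (hA.dartGraph.altX (1000 * dl) p q (altRounds n ε dl)) ∧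
      RepW hA (σ'.real 4) (hA.dartGraph.altY (1000 * dl) p q (altRounds n ε dl)) := by
  obtain ⟨σ₁, r1, h1⟩ := h.runs_write 4 (num 1)
  have c1 := h.of_runs r1 (by decide)
  have y1 : RepW hA (σ₁.real 4) (hA.dartGraph.altY (1000 * dl) p q 0) := fun j => by
    rw [h1, eval_num]; simp [DartGraph.altY]
  have p1 : RepD (σ₁.real 7) p := by rwa [r1.real_eq (by decide)]
  have q1 : RepW hA (σ₁.real 8) q := by rwa [r1.real_eq (by decide)]
  obtain ⟨σ₂, r2, h2⟩ := runs_xStep c1 p1 y1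
  have c2 := c1.of_runs r2 (by decide)
  obtain ⟨σ₃, r3, ⟨-, -, -, hx, hy⟩, -⟩ := runs_forLoop (m := off n + 1) (X := B + 1) (by omega)
    (by omega) (ctr := 6) (bound := altBound) (body := .seq yStep xStep)
    (fun k τ => Ctx hA ε dl τ ∧ RepD (τ.real 7) p ∧ RepW hA (τ.real 8) q ∧
      RepD (τ.real 3) (hA.dartGraph.altX (1000 * dl) p q k) ∧
      RepW hA (τ.real 4) (hA.dartGraph.altY (1000 * dl) p q k))
    (2 * Real.log (8000 * dl * n / ε))
    (by
      rintro k τ ⟨c, -⟩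
      simp [altBound, RExp.eval, eval_num, eval_scalar, c.eval_eVerts, c.eps, c.degBound])
    (by
      rintro k τ ⟨c, hp, hq, hx, hy⟩
      obtain ⟨τ₁, s1, hy1⟩ := runs_yStep c hB hq hx
      have c1 := c.of_runs s1 (by decide)
      obtain ⟨τ₂, s2, hx2⟩ := runs_xStep c1 (p := p) (by rwa [s1.real_eq (by decide)]) hy1
      have s := s1.seq (s2.mono (by omega))
      exact ⟨τ₂, s, c.of_runs s (by decide), by rwa [s.real_eq (by decide)],
        by rwa [s.real_eq (by decide)], hx2, by rw [s2.real_eq (by decide)]; exact hy1⟩)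
    (by decide) (by
      rintro k τ f ⟨c, h⟩
      exact ⟨c.setN f (by decide), h⟩)
    (σ := σ₂) ⟨c2, by rwa [r2.real_eq (by decide)], by rwa [r2.real_eq (by decide)], h2,
      by rwa [r2.real_eq (by decide)]⟩
  have hX : 1 ≤ (altRounds n ε dl + 1) * (B + 1) := Nat.mul_pos (by omega) (by omega)
  exact ⟨σ₃, (r1.mono hX).seq ((r2.mono hX).seq r3), hx, hy⟩

/-- The memory holds a state of dual extrapolation. -/
structure RepState (hA : IsAdjacencyArray G off adj) (σ : Mem)
    (s : DartGraph.State (Fin (off n)) {v : Fin n // 0 < G.degree v}) : Prop where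
  p : RepD (σ.real 5) s.p
  q : RepW hA (σ.real 6) s.q
  acc : RepW hA (σ.real 9) s.acc

lemma eval_addGradX (h : Ctx hA ε dl σ) {a c : ℕ} {p : Fin (off n) → ℝ}
    {y : {v : Fin n // 0 < G.degree v} → ℝ} (hp : RepD (σ.real a) p) (hy : RepW hA (σ.real 4) y)
    (j : Fin (off n)) : (addGradX a c).eval σ j = p j + c * hA.dartGraph.gradX y j := by
  simp only [addGradX, RExp.eval, eval_cell, eval_num, h.eval_headCell hy, hp j, hy j,
    DartGraph.gradX]

lemma eval_addGradY (h : Ctx hA ε dl σ) {a c : ℕ} {q : {v : Fin n // 0 < G.degree v} → ℝ}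
    {x : Fin (off n) → ℝ} (hq : RepW hA (σ.real a) q)
    (hs : ∀ j : Fin (off n), segSum.eval σ j = hA.dartGraph.outSum x (hA.dartGraph.tail j))
    (j : Fin (off n)) : (addGradY a c).eval σ j =
      q (hA.dartGraph.tail j) + c * hA.dartGraph.gradY x (hA.dartGraph.tail j) := by
  simp only [addGradY, RExp.eval, eval_cell, eval_num, h.eval_eDeg, hs, hq j, DartGraph.gradY]
  push_cast
  ring

lemma runs_mainStep (h : Ctx hA ε dl σ) {B : ℕ} (hB : Nat.clog 2 (off n + 1) ≤ B)
    {s : DartGraph.State (Fin (off n)) {v : Fin n // 0 < G.degree v}} (hs : RepState hA σ s) :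
    ∃ σ', Runs (off n + 1) ((altRounds n ε dl + 1) * (B + 1)) mainStep σ σ' ∧ Ctx hA ε dl σ' ∧
      RepState hA σ' (hA.dartGraph.step (1000 * dl) (altRounds n ε dl) s) := by
  have hX : 1 ≤ (altRounds n ε dl + 1) * (B + 1) := Nat.mul_pos (by omega) (by omega)
  have hX' : B + 1 ≤ (altRounds n ε dl + 1) * (B + 1) := Nat.le_mul_of_pos_left _ (by omega)
  set K := altRounds n ε dl with hK
  set Γ := hA.dartGraph with hΓ
  obtain ⟨σ₁, r1, h1⟩ := h.runs_write 7 (cell 5)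
  have c1 := h.of_runs r1 (by decide)
  obtain ⟨σ₂, r2, h2⟩ := c1.runs_write 8 (cell 6)
  have c2 := c1.of_runs r2 (by decide)
  obtain ⟨σ₃, r3, x3, y3⟩ := runs_altMin c2 hB (p := s.p) (q := s.q)
    (fun j => by rw [r2.real_eq (by decide), h1, eval_cell, hs.p j])
    (fun j => by rw [h2, eval_cell, r1.real_eq (by decide), hs.q j])
  have c3 := c2.of_runs r3 (by decide)
  rw [← hK] at x3 y3
  obtain ⟨σ₄, r4, c4, h4, -⟩ := c3.runs_sum hB (e := cell 3) (fun j => by rw [eval_cell, x3 j])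
  obtain ⟨σ₅, r5, h5⟩ := c4.runs_write 7 (addGradX 5 2)
  have c5 := c4.of_runs r5 (by decide)
  obtain ⟨σ₆, r6, h6⟩ := c5.runs_write 8 (addGradY 6 2)
  have c6 := c5.of_runs r6 (by decide)
  have p4 : RepD (σ₄.real 5) s.p := by
    rw [r4.real_eq (by decide), r3.real_eq (by decide), r2.real_eq (by decide),
      r1.real_eq (by decide)]
    exact hs.p
  have q5 : RepW hA (σ₅.real 6) s.q := by
    rw [r5.real_eq (by decide), r4.real_eq (by decide), r3.real_eq (by decide),
      r2.real_eq (by decide), r1.real_eq (by decide)]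
    exact hs.q
  have y4 : RepW hA (σ₄.real 4) (Γ.altY (1000 * dl) s.p s.q K) := by
    rwa [r4.real_eq (by decide)]
  -- Real array `2` still holds the prefix sums of the box vector: the write since the scan went to
  -- array `7`.
  have seg5 : ∀ j : Fin (off n), segSum.eval σ₅ j =
      Γ.outSum (Γ.altX (1000 * dl) s.p s.q K) (Γ.tail j) := by
    intro j
    rw [← h4]
    simp only [segSum, RExp.eval, c5.eval_eFst, c5.eval_eEnd, c4.eval_eFst, c4.eval_eEnd,
      r5.real_eq (show 2 ∉ _ by decide)]
  obtain ⟨σ₇, r7, x7, y7⟩ := runs_altMin c6 hB (p := Γ.shiftP (1000 * dl) K s)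
    (q := Γ.shiftQ (1000 * dl) K s)
    (fun j => by
      rw [r6.real_eq (by decide), h5, eval_addGradX c4 p4 y4]; norm_num [DartGraph.shiftP, hΓ])
    (fun j => by
      rw [h6, eval_addGradY c5 q5 seg5]; norm_num [DartGraph.shiftQ, hΓ])
  have c7 := c6.of_runs r7 (by decide)
  rw [← hK] at x7 y7
  obtain ⟨σ₈, r8, c8, h8, -⟩ := c7.runs_sum hB (e := cell 3) (fun j => by rw [eval_cell, x7 j])
  obtain ⟨σ₉, r9, h9⟩ := c8.runs_write 5 (addGradX 5 1)
  have c9 := c8.of_runs r9 (by decide)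
  obtain ⟨τ, r10, h10⟩ := c9.runs_write 6 (addGradY 6 1)
  have c10 := c9.of_runs r10 (by decide)
  obtain ⟨υ, r11, h11⟩ := c10.runs_write 9 (.add (cell 9) (cell 4))
  have c11 := c10.of_runs r11 (by decide)
  have r58 : ∀ a ∈ [5, 6, 9], σ₈.real a = σ₄.real a := by
    intro a ha
    fin_cases ha <;> rw [r8.real_eq (by decide), r7.real_eq (by decide), r6.real_eq (by decide),
      r5.real_eq (by decide)]
  have r04 : ∀ a ∈ [5, 6, 9], σ₄.real a = σ.real a := by
    intro a ha
    fin_cases ha <;> rw [r4.real_eq (by decide), r3.real_eq (by decide), r2.real_eq (by decide),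
      r1.real_eq (by decide)]
  have y8 : RepW hA (σ₈.real 4) (Γ.iterY (1000 * dl) K s) := by
    rw [r8.real_eq (by decide)]; exact y7
  have seg9 : ∀ j : Fin (off n), segSum.eval σ₉ j =
      Γ.outSum (Γ.iterX (1000 * dl) K s) (Γ.tail j) := by
    intro j
    rw [show Γ.outSum (Γ.iterX (1000 * dl) K s) (Γ.tail j) = segSum.eval σ₈ j from (h8 j).symm]
    simp only [segSum, RExp.eval, c9.eval_eFst, c9.eval_eEnd, c8.eval_eFst, c8.eval_eEnd,
      r9.real_eq (show 2 ∉ _ by decide)]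
  refine ⟨υ, (r1.mono hX).seq <| (r2.mono hX).seq <| r3.seq <| (r4.mono hX').seq <|
    (r5.mono hX).seq <| (r6.mono hX).seq <| r7.seq <| (r8.mono hX').seq <| (r9.mono hX).seq <|
    (r10.mono hX).seq (r11.mono hX), c11, ⟨fun j => ?_, fun j => ?_, fun j => ?_⟩⟩
  · rw [r11.real_eq (by decide), r10.real_eq (by decide), h9, eval_addGradX c8 (p := s.p) ?_ y8]
    · norm_num [DartGraph.step, hΓ]
    · rw [r58 5 (by simp), r04 5 (by simp)]; exact hs.p
  · rw [r11.real_eq (by decide), h10, eval_addGradY c9 (q := s.q) ?_ seg9]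
    · norm_num [DartGraph.step, hΓ]
    · rw [r9.real_eq (by decide), r58 6 (by simp), r04 6 (by simp)]; exact hs.q
  · rw [h11]
    simp only [RExp.eval, eval_cell]
    rw [r10.real_eq (by decide), r9.real_eq (by decide), r58 9 (by simp), r04 9 (by simp), hs.acc j,
      r10.real_eq (by decide), r9.real_eq (by decide), y8 j]
    rfl

end


section

variable {n : ℕ} {G : SimpleGraph (Fin n)} [DecidableRel G.Adj] {off adj : ℕ → ℕ}

/-! ### The degree bound -/

/-- A norm of the degree sequence that approximates the maximum degree. -/
def degNorm (hA : IsAdjacencyArray G off adj) : ℝ :=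
  Real.exp (Real.log (∑ j, Real.exp (Real.log n *
    Real.log (hA.dartGraph.deg (hA.dartGraph.tail j)))) / Real.log n)

variable (hA : IsAdjacencyArray G off adj)

lemma one_le_deg (w : {v : Fin n // 0 < G.degree v}) : 1 ≤ hA.dartGraph.deg w := by
  rw [hA.deg_eq]; exact_mod_cast w.2

/-- One dart leaving `w` already contributes `deg w` to the power `log n`. -/
lemma deg_le_degNorm (hn : 2 ≤ n) (w : {v : Fin n // 0 < G.degree v}) :
    hA.dartGraph.deg w ≤ degNorm hA := by
  have hlog : 0 < Real.log n := Real.log_pos (by exact_mod_cast hn)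
  have hd : 0 < hA.dartGraph.deg w := one_pos.trans_le (one_le_deg hA w)
  have h1 : Real.exp (Real.log n * Real.log (hA.dartGraph.deg w)) ≤
      ∑ j, Real.exp (Real.log n * Real.log (hA.dartGraph.deg (hA.dartGraph.tail j))) := by
    have := Finset.single_le_sum (f := fun j => Real.exp (Real.log n *
      Real.log (hA.dartGraph.deg (hA.dartGraph.tail j)))) (fun j _ => (Real.exp_pos _).le)
      (Finset.mem_univ ⟨_, hA.off_lt w⟩)
    simpa only [hA.tail_off] using this
  have h2 := Real.log_le_log (Real.exp_pos _) h1
  rw [Real.log_exp] at h2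
  rw [← Real.exp_log hd, degNorm, Real.exp_le_exp, le_div_iff₀ hlog]
  linarith

lemma off_le (hA : IsAdjacencyArray G off adj) : off n ≤ n * n := by
  rw [hA.off_eq_sum]
  calc ∑ v, G.degree v ≤ ∑ _v : Fin n, n :=
        Finset.sum_le_sum fun v _ => (G.degree_lt_card_verts v).le.trans (by simp)
    _ = n * n := by simp

/-- There are at most `n ^ 2` darts, and `(n ^ 2) ^ (1 / log n) = e ^ 2 ≤ 8`. -/
lemma degNorm_le (hn : 2 ≤ n) (hE : G.edgeFinset.Nonempty) :
    degNorm hA ≤ 8 * G.maxDegree := by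
  have hlog : 0 < Real.log n := Real.log_pos (by exact_mod_cast hn)
  have hn0 : (0 : ℝ) < n := by positivity
  have hM : 0 < off n := by rw [hA.off_eq]; have := hE.card_pos; omega
  have hw := (hA.dartGraph.tail ⟨0, hM⟩).2
  have hΔ : (0 : ℝ) < G.maxDegree := by
    exact_mod_cast hw.trans_le (G.degree_le_maxDegree _)
  have h1 : ∑ j, Real.exp (Real.log n * Real.log (hA.dartGraph.deg (hA.dartGraph.tail j))) ≤
      (n : ℝ) ^ 2 * Real.exp (Real.log n * Real.log G.maxDegree) := by
    calc _ ≤ ∑ _j : Fin (off n), Real.exp (Real.log n * Real.log G.maxDegree) := by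
          refine Finset.sum_le_sum fun j _ => Real.exp_le_exp.2
            (mul_le_mul_of_nonneg_left (Real.log_le_log (one_pos.trans_le (one_le_deg hA _)) ?_)
              hlog.le)
          rw [hA.deg_eq]; exact_mod_cast G.degree_le_maxDegree _
      _ = (off n : ℝ) * Real.exp (Real.log n * Real.log G.maxDegree) := by simp
      _ ≤ _ := by
          gcongr
          rw [sq]; exact_mod_cast off_le hA
  have hpos : 0 < ∑ j, Real.exp (Real.log n *
      Real.log (hA.dartGraph.deg (hA.dartGraph.tail j))) :=
    Finset.sum_pos (fun _ _ => Real.exp_pos _) ⟨⟨0, hM⟩, Finset.mem_univ _⟩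
  have h2 := Real.log_le_log hpos h1
  rw [Real.log_mul (by positivity) (Real.exp_pos _).ne', Real.log_exp, Real.log_pow] at h2
  have h3 : degNorm hA ≤ Real.exp (2 + Real.log G.maxDegree) := by
    rw [degNorm, Real.exp_le_exp, div_le_iff₀ hlog]
    push_cast at h2
    linarith
  rw [Real.exp_add, Real.exp_log hΔ] at h3
  refine h3.trans (mul_le_mul_of_nonneg_right ?_ hΔ.le)
  have h4 := Real.exp_one_lt_d9
  have h5 : Real.exp 2 = Real.exp 1 * Real.exp 1 := by rw [← Real.exp_add]; norm_num
  have h6 := Real.exp_pos 1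
  rw [h5]
  nlinarith

/-! ### The whole program -/

variable {hA}

lemma runs_degBound {ε dl : ℝ} {σ : Mem} (h : Ctx hA ε dl σ) {B : ℕ}
    (hB : Nat.clog 2 (off n + 1) ≤ B) :
    ∃ σ', Runs (off n + 1) (B + 1) degBound σ σ' ∧ Ctx hA ε (degNorm hA) σ' := by
  obtain ⟨σ₁, r1, c1, -, h1⟩ := h.runs_sum hB (e := .exp (.mul (.log (.ofNat eVerts)) (.log eDeg)))
    (x := fun j => Real.exp (Real.log n * Real.log (hA.dartGraph.deg (hA.dartGraph.tail j))))
    (fun j => by simp only [RExp.eval, h.eval_eVerts, h.eval_eDeg])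
  obtain ⟨f, r2, h2, -⟩ := runs_parR (show 1 ≤ off n + 1 by omega) σ₁ 10 (.const 1)
    (.exp (.div (.log total) (.log (.ofNat eVerts)))) .tt (show 1 ≤ off n + 1 by omega)
  refine ⟨_, r1.seq (r2.mono (by omega)), c1.off_eq, c1.adj_eq, c1.verts, c1.tail, ?_, ?_⟩
  · simpa using c1.eps
  · simp only [Mem.setR_real, if_true]
    rw [h2 0 one_pos (BExp.eval_tt _ _)]
    simp only [RExp.eval, h1, c1.eval_eVerts, degNorm]

lemma runs_main {ε dl : ℝ} {σ : Mem} (h : Ctx hA ε dl σ) {B : ℕ}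
    (hB : Nat.clog 2 (off n + 1) ≤ B) (h5 : σ.real 5 = fun _ => 0) (h6 : σ.real 6 = fun _ => 0)
    (h9 : σ.real 9 = fun _ => 0) :
    ∃ σ', Runs (off n + 1) ((mainRounds n ε dl + 1) * ((altRounds n ε dl + 1) * (B + 1)))
        (forLoop 5 mainBound mainStep) σ σ' ∧ Ctx hA ε dl σ' ∧
      RepState hA σ' (hA.dartGraph.state (1000 * dl) (altRounds n ε dl) (mainRounds n ε dl)) ∧
      σ'.nat 5 0 = mainRounds n ε dl := by
  obtain ⟨σ', r, ⟨c, hs⟩, ht⟩ := runs_forLoop (m := off n + 1) (by omega)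
    (X := (altRounds n ε dl + 1) * (B + 1))
    (Nat.mul_pos (by omega) (by omega)) (ctr := 5) (bound := mainBound) (body := mainStep)
    (fun k τ => Ctx hA ε dl τ ∧
      RepState hA τ (hA.dartGraph.state (1000 * dl) (altRounds n ε dl) k))
    (3000 * dl * Real.log n / ε)
    (by
      rintro k τ ⟨c, -⟩
      simp [mainBound, RExp.eval, eval_num, eval_scalar, c.eval_eVerts, c.eps, c.degBound])
    (by
      rintro k τ ⟨c, hs⟩
      exact runs_mainStep c hB hs)
    (by decide)
    (by
      rintro k τ f ⟨c, hs⟩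
      exact ⟨c.setN f (by decide), ⟨hs.p, hs.q, hs.acc⟩⟩)
    (σ := σ) ⟨h, ⟨fun j => by rw [h5]; rfl, fun j => by rw [h6]; rfl, fun j => by rw [h9]; rfl⟩⟩
  exact ⟨σ', r, c, hs, ht⟩

lemma runs_finish {ε dl : ℝ} {σ : Mem} (h : Ctx hA ε dl σ) {B : ℕ}
    (hB : Nat.clog 2 (off n + 1) ≤ B) {y : {v : Fin n // 0 < G.degree v} → ℝ}
    (hy : RepW hA (σ.real 9) y) :
    ∃ σ', Runs (off n + 1) (B + 1) finish σ σ' ∧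
      σ'.output = hA.dartGraph.minSum y / (2 * σ.nat 5 0) := by
  obtain ⟨σ₁, r1, h1⟩ := h.runs_write 3 (cell 9)
  have c1 := h.of_runs r1 (by decide)
  have y1 : RepW hA (σ₁.real 9) y := by rwa [r1.real_eq (by decide)]
  obtain ⟨σ₂, r2, h2⟩ := c1.runs_guarded 3 (headCell 9) (.rlt (headCell 9) (cell 9))
  have c2 := c1.of_runs r2 (by decide)
  obtain ⟨σ₃, r3, c3, -, h3⟩ := c2.runs_sum hB (e := cell 3)
    (x := fun j => min (y (hA.dartGraph.tail j)) (y (hA.dartGraph.head j)))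
    (fun j => by
      rw [eval_cell, h2]
      simp only [BExp.eval, c1.eval_headCell y1, eval_cell, y1 j, h1, hy j]
      rw [min_def]
      split_ifs <;> linarith)
  obtain ⟨f, r4, h4, -⟩ := runs_parR (show 1 ≤ off n + 1 by omega) σ₃ 1 (.const 1)
    (.div total (.mul (num 2) (.ofNat (.read 5 (.const 0))))) .tt (show 1 ≤ off n + 1 by omega)
  refine ⟨_, (r1.mono (by omega)).seq ((r2.mono (by omega)).seq (r3.seq (r4.mono (by omega)))), ?_⟩
  simp only [Mem.output, Mem.setR_real, if_true]
  rw [h4 0 one_pos (BExp.eval_tt _ _)]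
  simp only [RExp.eval, NExp.eval, h3, eval_num, r3.nat_eq (show 5 ∉ _ by decide),
    r2.nat_eq (show 5 ∉ _ by decide), r1.nat_eq (show 5 ∉ _ by decide), DartGraph.minSum]
  norm_num

lemma runs_densest (hA : IsAdjacencyArray G off adj) {B : ℕ} (hB : Nat.clog 2 (off n + 1) ≤ B)
    (hB' : Nat.clog 2 n ≤ B) (ε : ℝ) :
    ∃ σ, Runs (off n + 1) ((mainRounds n ε (degNorm hA) + 1) *
        ((altRounds n ε (degNorm hA) + 1) * (B + 1))) densest (inputMem n off adj ε) σ ∧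
      σ.output = hA.dartGraph.minSum (hA.dartGraph.state (1000 * degNorm hA)
        (altRounds n ε (degNorm hA)) (mainRounds n ε (degNorm hA))).acc /
          (2 * mainRounds n ε (degNorm hA)) := by
  obtain ⟨σ₁, r1, h1⟩ := runs_findTails hA hB' (σ := inputMem n off adj ε)
    (by funext j; simp [inputMem]) (by simp [inputMem]) (by simp [inputMem])
  -- The cell of the degree bound still has its initial value 0.
  have c1 : Ctx hA ε 0 σ₁ := by
    refine ⟨?_, ?_, ?_, h1, ?_, ?_⟩
    · rw [r1.nat_eq (by decide)]; funext j; simp [inputMem]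
    · rw [r1.nat_eq (by decide)]; funext j; simp [inputMem]
    · rw [r1.nat_eq (by decide)]; simp [inputMem]
    · rw [r1.real_eq (by decide)]; simp [inputMem]
    · rw [r1.real_eq (by decide)]; simp [inputMem]
  obtain ⟨σ₂, r2, c2⟩ := runs_degBound c1 hB
  obtain ⟨σ₃, r3, c3, s3, t3⟩ := runs_main c2 hB
    (by rw [r2.real_eq (by decide), r1.real_eq (by decide)]; funext j; simp [inputMem])
    (by rw [r2.real_eq (by decide), r1.real_eq (by decide)]; funext j; simp [inputMem])
    (by rw [r2.real_eq (by decide), r1.real_eq (by decide)]; funext j; simp [inputMem])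
  obtain ⟨σ₄, r4, h4⟩ := runs_finish c3 hB s3.acc
  have hX : B + 1 ≤ (mainRounds n ε (degNorm hA) + 1) *
        ((altRounds n ε (degNorm hA) + 1) * (B + 1)) :=
    (Nat.le_mul_of_pos_left _ (by omega)).trans (Nat.le_mul_of_pos_left _ (by omega))
  refine ⟨σ₄, (r1.mono hX).seq ((r2.mono hX).seq (r3.seq (r4.mono hX))), ?_⟩
  rw [h4, t3]

/-! ### Correctness and complexity -/

lemma two_le_of_edge (hE : G.edgeFinset.Nonempty) : 2 ≤ n := by
  obtain ⟨e, he⟩ := hE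
  induction e with
  | _ a b =>
    have hab : G.Adj a b := by simpa using he
    have := hab.ne
    have : (a : ℕ) ≠ b := fun h => this (Fin.ext h)
    omega

/-- The factor 2 in the number of rounds replaces a logarithm to base 2, since `2 * log 2 ≥ 1`. -/
lemma le_two_pow_altRounds {ε dl : ℝ} (h : 1 ≤ 8000 * dl * n / ε) :
    8000 * dl * n / ε ≤ 2 ^ altRounds n ε dl := by
  set A := 8000 * dl * n / ε with hA
  have hA0 : 0 < A := by linarith
  have h1 : 2 * Real.log A ≤ altRounds n ε dl := Nat.le_ceil _
  have h2 := Real.log_nonneg h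
  have h3 := Real.log_two_gt_d9
  rw [← Real.log_le_log_iff hA0 (by positivity), Real.log_pow]
  nlinarith

/-- Error budget for `2 * T * minSum y`: the choice of `T` makes the range of the regularizer at
most `T * ε / 2`, and the choice of `K` makes the inexact minimizations cost at most `2 * T * ε /
8`. The total is below `T * ε`, an error of `ε / 4` in the density. -/
lemma approximation (hA : IsAdjacencyArray G off adj) (hE : G.edgeFinset.Nonempty) {ε : ℝ}
    (hε : 0 < ε) (hε1 : ε ≤ 1) {out : ℝ} (hout : out = hA.dartGraph.minSum
      (hA.dartGraph.state (1000 * degNorm hA) (altRounds n ε (degNorm hA))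
        (mainRounds n ε (degNorm hA))).acc / (2 * mainRounds n ε (degNorm hA))) :
    out ≤ maxSubgraphDensity G ∧ maxSubgraphDensity G ≤ (1 + ε) * out := by
  have hn := two_le_of_edge hE
  have hnR : (2 : ℝ) ≤ n := by exact_mod_cast hn
  have hM : 0 < off n := by rw [hA.off_eq]; have := hE.card_pos; omega
  have : Nonempty {v : Fin n // 0 < G.degree v} := ⟨hA.dartGraph.tail ⟨0, hM⟩⟩
  set dl := degNorm hA with hdl
  have hd : ∀ w, hA.dartGraph.deg w ≤ dl := deg_le_degNorm hA hn
  have hdl1 : 1 ≤ dl := (one_le_deg hA (Classical.arbitrary _)).trans (hd _)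
  have hA1 : 8000 ≤ 8000 * dl * n / ε := by
    rw [le_div_iff₀ hε]; nlinarith
  have hpow := le_two_pow_altRounds (n := n) (ε := ε) (dl := dl) (by linarith)
  set K := altRounds n ε dl with hKdef
  have hK : K ≠ 0 := by
    intro h; rw [h] at hpow; norm_num at hpow; linarith
  set T := mainRounds n ε dl with hTdef
  have hlog2 := Real.log_two_gt_d9
  have hlogn : Real.log 2 ≤ Real.log n := Real.log_le_log two_pos hnR
  have hT : 3000 * dl * Real.log n / ε ≤ T := Nat.le_ceil _
  have hT0 : (0 : ℝ) < T := by
    refine lt_of_lt_of_le ?_ hT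
    have : 0 < Real.log n := by linarith
    positivity
  rw [div_le_iff₀ hε] at hT
  have hcard : Fintype.card {v : Fin n // 0 < G.degree v} ≤ n := by
    simpa using Fintype.card_subtype_le (fun v : Fin n => 0 < G.degree v)
  have hcardR : (Fintype.card {v : Fin n // 0 < G.degree v} : ℝ) ≤ n := by exact_mod_cast hcard
  have hcard0 : (0 : ℝ) < Fintype.card {v : Fin n // 0 < G.degree v} := by
    exact_mod_cast Fintype.card_pos
  have hδ : 1000 * dl * Fintype.card {v : Fin n // 0 < G.degree v} / 2 ^ K ≤ ε / 8 := by
    rw [div_le_iff₀ (by positivity)]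
    rw [div_le_iff₀ hε] at hpow
    have : dl * Fintype.card {v : Fin n // 0 < G.degree v} ≤ dl * n := by gcongr
    linarith
  have hlogc : Real.log (Fintype.card {v : Fin n // 0 < G.degree v}) ≤ Real.log n :=
    Real.log_le_log hcard0 hcardR
  set acc := (hA.dartGraph.state (1000 * dl) K T).acc with hacc
  have hms : hA.dartGraph.minSum acc = out * (2 * T) := by
    rw [hout]; field_simp
  have hlow : out ≤ maxSubgraphDensity G := by
    have h1 := hA.minSum_le (DartGraph.acc_nonneg (Γ := hA.dartGraph) (1000 * dl) hK T)
    rw [DartGraph.sum_acc _ hK, hms] at h1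
    have h2 : (2 * T) * out ≤ (2 * T) * maxSubgraphDensity G := by linarith
    exact le_of_mul_le_mul_left h2 (by positivity)
  have hR : 2 * dl + 1000 * dl * Real.log (Fintype.card {v : Fin n // 0 < G.degree v}) ≤
      T * ε / 2 := by
    have h1 : dl * Real.log (Fintype.card {v : Fin n // 0 < G.degree v}) ≤ dl * Real.log n := by
      gcongr
    have h2 : dl * (2 / 3) ≤ dl * Real.log n := by gcongr; linarith
    linarith
  have hup : ∀ y : {v : Fin n // 0 < G.degree v} → ℝ, (∀ w, 0 ≤ y w) → ∑ w, y w = 1 →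
      hA.dartGraph.minSum y ≤ 2 * (out + ε / 4) := by
    intro y hy hy1
    have h1 := DartGraph.minSum_le_average hd (by linarith) (by linarith) hK hδ T hy hy1
    rw [← hacc, hms] at h1
    have h2 : (2 * T) * hA.dartGraph.minSum y ≤ (2 * T) * (2 * (out + ε / 4)) := by
      linarith [mul_pos hT0 hε]
    exact le_of_mul_le_mul_left h2 (by positivity)
  have hout0 : 0 ≤ out := by
    rw [hout]
    exact div_nonneg (Finset.sum_nonneg fun j _ => le_min
      (DartGraph.acc_nonneg _ hK _ _) (DartGraph.acc_nonneg _ hK _ _)) (by positivity)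
  have h3 := hA.density_le (c := out + ε / 4) (by linarith) hup
  have h4 := half_le_maxSubgraphDensity G hE
  -- The density is at least `1 / 2`, so `out ≥ 1 / 2 - ε / 4 ≥ 1 / 4` and the additive error `ε /
  -- 4` is at most `ε * out`.
  refine ⟨hlow, ?_⟩
  nlinarith

lemma clog_le {N : ℕ} (hN : 2 ≤ N) : (Nat.clog 2 N : ℝ) ≤ 1 + 2 * Real.log N := by
  have h := Nat.pow_pred_clog_lt_self one_lt_two hN
  have h1 : 0 < Nat.clog 2 N := Nat.clog_pos one_lt_two hN
  obtain ⟨k, hk⟩ : ∃ k, Nat.clog 2 N = k + 1 := ⟨Nat.clog 2 N - 1, by omega⟩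
  rw [hk] at h ⊢
  have h2 : ((2 : ℝ) ^ k) ≤ N := by exact_mod_cast h.le
  have h3 := Real.log_le_log (by positivity) h2
  rw [Real.log_pow] at h3
  have h4 := Real.log_two_gt_d9
  push_cast
  have : (0 : ℝ) ≤ k := Nat.cast_nonneg _
  nlinarith

/-- The total number of rounds. -/
lemma rounds_le (hA : IsAdjacencyArray G off adj) (hE : G.edgeFinset.Nonempty) {ε : ℝ}
    (hε : 0 < ε) (hε1 : ε ≤ 1) :
    (((mainRounds n ε (degNorm hA) + 1) * ((altRounds n ε (degNorm hA) + 1) *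
      (Nat.clog 2 (off n + 1) + Nat.clog 2 n + 1)) : ℕ) : ℝ) ≤
      20000000 * (G.maxDegree / ε) * Real.log (n / ε) ^ 3 := by
  have hn := two_le_of_edge hE
  have hnR : (2 : ℝ) ≤ n := by exact_mod_cast hn
  have hM : 0 < off n := by rw [hA.off_eq]; have := hE.card_pos; omega
  have hΔ : (1 : ℝ) ≤ G.maxDegree := by
    exact_mod_cast (hA.dartGraph.tail ⟨0, hM⟩).2.trans_le (G.degree_le_maxDegree _)
  have hΔn : (G.maxDegree : ℝ) ≤ n := by
    have : Nonempty (Fin n) := ⟨⟨0, by omega⟩⟩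
    have := G.maxDegree_lt_card_verts
    rw [Fintype.card_fin] at this
    exact_mod_cast this.le
  have hdl := degNorm_le hA hn hE
  have hdl1 : 1 ≤ degNorm hA :=
    (one_le_deg hA (hA.dartGraph.tail ⟨0, hM⟩)).trans (deg_le_degNorm hA hn _)
  set dl := degNorm hA with hdldef
  set D : ℝ := (G.maxDegree : ℝ)
  set l := Real.log (n / ε) with hl
  have hlog2 := Real.log_two_gt_d9
  have hnε : (n : ℝ) ≤ n / ε := by rw [le_div_iff₀ hε]; nlinarith
  have hlogn : Real.log n ≤ l := Real.log_le_log (by linarith) hnε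
  have hlogn2 : Real.log 2 ≤ Real.log n := Real.log_le_log two_pos hnR
  have hl1 : 1 / 2 ≤ l := by linarith
  have hDε : 1 ≤ D / ε := by rw [le_div_iff₀ hε]; linarith
  have hB : ((Nat.clog 2 (off n + 1) + Nat.clog 2 n + 1 : ℕ) : ℝ) ≤ 14 * l := by
    have h1 := clog_le hn
    have h2 := clog_le (show 2 ≤ off n + 1 by omega)
    have h3 : Real.log ((off n + 1 : ℕ) : ℝ) ≤ 3 * Real.log n := by
      have : Real.log ((n : ℝ) ^ 3) = 3 * Real.log n := by rw [Real.log_pow]; norm_num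
      rw [← this]
      refine Real.log_le_log (by positivity) ?_
      have h4 := off_le hA
      have h5 : off n + 1 ≤ n ^ 3 := by nlinarith
      exact_mod_cast h5
    push_cast at h3 ⊢
    push_cast at h2
    linarith
  have hK : ((altRounds n ε dl + 1 : ℕ) : ℝ) ≤ 40 * l := by
    have hA1 : 1 ≤ 8000 * dl * n / ε := by
      rw [le_div_iff₀ hε]; nlinarith
    have h1 : (altRounds n ε dl : ℝ) < 2 * Real.log (8000 * dl * n / ε) + 1 :=
      Nat.ceil_lt_add_one (mul_nonneg two_pos.le (Real.log_nonneg hA1))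
    -- Since `dl ≤ 8 * Δ ≤ 8 * (n / ε)`, the argument of the logarithm is polynomial in `n / ε`.
    have h2 : 8000 * dl * n / ε ≤ 2 ^ 16 * (n / ε) ^ 2 := by
      have : dl * (n / ε) ≤ 8 * (n / ε) * (n / ε) := by
        gcongr; linarith
      have h0 : 8000 * dl * n / ε = 8000 * (dl * (n / ε)) := by ring
      rw [h0]
      nlinarith [sq_nonneg (n / ε)]
    have h3 := Real.log_le_log (by linarith) h2
    rw [Real.log_mul (by positivity) (by positivity), Real.log_pow, Real.log_pow] at h3
    push_cast at h3 ⊢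
    linarith
  have hT : ((mainRounds n ε dl + 1 : ℕ) : ℝ) ≤ 24004 * (D / ε * l) := by
    have h0 : 0 ≤ 3000 * dl * Real.log n / ε := by
      have : 0 ≤ Real.log n := by linarith
      positivity
    have h1 : (mainRounds n ε dl : ℝ) < 3000 * dl * Real.log n / ε + 1 := Nat.ceil_lt_add_one h0
    have h2 : 3000 * dl * Real.log n / ε ≤ 3000 * (8 * D) * l / ε := by gcongr
    have h3 : 3000 * (8 * D) * l / ε = 24000 * (D / ε * l) := by ring
    have h4 : 1 / 2 ≤ D / ε * l := by nlinarith
    push_cast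
    linarith
  rw [Nat.cast_mul, Nat.cast_mul]
  calc _ ≤ 24004 * (D / ε * l) * ((40 * l) * (14 * l)) := by gcongr
    _ = 13442240 * (D / ε * l ^ 3) := by ring
    _ ≤ 20000000 * (D / ε * l ^ 3) := by
      have : 0 ≤ D / ε * l ^ 3 := by positivity
      linarith
    _ = _ := by ring

end

end PRAM

end

theorem mainTheorem3 :
    ∃ (prog : PRAM.Cmd) (C : ℝ) (k : ℕ),
      ∀ (n : ℕ) (G : SimpleGraph (Fin n)) [DecidableRel G.Adj] (off adj : ℕ → ℕ) (ε : ℝ),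
        IsAdjacencyArray G off adj → G.edgeFinset.Nonempty → 0 < ε → ε ≤ 1 →
        ∃ (σ : PRAM.Mem) (time work : ℕ),
          PRAM.Exec prog (PRAM.inputMem n off adj ε) σ time work ∧
          σ.output ≤ maxSubgraphDensity G ∧
          maxSubgraphDensity G ≤ (1 + ε) * σ.output ∧
          (time : ℝ) ≤ C * ((G.maxDegree : ℝ) / ε) * Real.log ((n : ℝ) / ε) ^ k ∧
          (work : ℝ) ≤ C * ((G.maxDegree : ℝ) * (G.edgeFinset.card : ℝ) / ε) *
            Real.log ((n : ℝ) / ε) ^ k := by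
  -- The constant 20000000 of `rounds_le` is tripled because `off n + 1 = 2|E| + 1 ≤ 3|E|`
  -- processors enter the work.
  refine ⟨PRAM.densest, 60000000 * PRAM.densest.ops, 3, ?_⟩
  intro n G _ off adj ε hA hE hε hε1
  obtain ⟨σ, ⟨t, w, e, ht, hw⟩, hout⟩ := PRAM.runs_densest hA
    (B := Nat.clog 2 (off n + 1) + Nat.clog 2 n) (by omega) (by omega) ε
  have hap := PRAM.approximation hA hE hε hε1 hout
  have hX := PRAM.rounds_le hA hE hε hε1
  set X := (PRAM.mainRounds n ε (PRAM.degNorm hA) + 1) *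
    ((PRAM.altRounds n ε (PRAM.degNorm hA) + 1) *
      (Nat.clog 2 (off n + 1) + Nat.clog 2 n + 1))
  set c := PRAM.densest.ops
  have hm : 1 ≤ G.edgeFinset.card := hE.card_pos
  have hmR : (1 : ℝ) ≤ G.edgeFinset.card := by exact_mod_cast hm
  have hoff : off n + 1 ≤ 3 * G.edgeFinset.card := by rw [hA.off_eq]; omega
  have htR : (t : ℝ) ≤ X * c := by exact_mod_cast ht
  have hwR : (w : ℝ) ≤ X * c * (3 * G.edgeFinset.card) := by
    exact_mod_cast hw.trans (Nat.mul_le_mul_left _ hoff)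
  have hXc : (X : ℝ) * c ≤ 20000000 * (G.maxDegree / ε) * Real.log (n / ε) ^ 3 * c := by gcongr
  refine ⟨σ, t, w, e, hap.1, hap.2, ?_, ?_⟩
  · have h0 : 0 ≤ (X : ℝ) * c := by positivity
    linarith
  · have h1 : (X : ℝ) * c * (3 * G.edgeFinset.card) ≤
      20000000 * (G.maxDegree / ε) * Real.log (n / ε) ^ 3 * c * (3 * G.edgeFinset.card) := by gcongr
    refine (hwR.trans h1).trans (le_of_eq ?_)
    ring
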